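/- Let $\mathbb{G}$ be a group with a finite symmetric set of generators $\Gamma$ (that is, $\Gamma=\Gamma^{-1}$). For $g\in\mathbb{G}$ let $\rho(g)$ be the least $m\ge 0$ such that $g$ is a product of $m$ elements of $\Gamma$, and for $n\ge1$ let $\mathcal{V}(n)=|\{g\in\mathbb{G}:\rho(g)\le n\}|$. Say that $\mathbb{G}$ has growth index $d\in\{0,1,2,\dots\}$ if there are constants $c,C>0$ with $c\,n^d\le\mathcal{V}(n)\le C\,n^d$ for all $n\ge1$, and growth index $d=\infty$ if for every $q\in\{0,1,2,\dots\}$ there is $c_q>0$ with $\mathcal{V}(n)\ge c_q\,n^q$ for all $n\ge1$. Let $X_1,X_2,\dots$ be independent random elements, uniformly distributed on $\Gamma$. For $g\in\mathbb{G}$ let $\mathbb{P}_g$ be the law of the random walk $S_0=g$, $S_{n+1}=S_nX_{n+1}$, and write $\mathbb{P}=\mathbb{P}_e$, where $e$ is the identity. For $A\subseteq\mathbb{G}$ put $\tau_A^+=\inf\{n\ge1:S_n\in A\}$ (with $\inf\emptyset=\infty$) and $$\operatorname{Cap}(A)=\sum_{g\in A}\mathbb{P}_g(\tau_A^+=\infty).$$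 Under $\mathbb{P}$ let $\mathcal{R}_n=\{S_0,\dots,S_n\}$ and $\mathcal{C}_n=\operatorname{Cap}(\mathcal{R}_n)$, a random variable. Suppose that $\mathbb{G}$ has growth index $d\ge6$, where $d=\infty$ is allowed. Then every $\mathcal{C}_n$ is square-integrable under $\mathbb{P}$, and the sequence $\{\operatorname{Var}(\mathcal{C}_n)/n\}_{n\ge1}$ converges to a finite limit in $\mathbb{R}$. -/

import Mathlib

open MeasureTheory ProbabilityTheory Filter Topology
open scoped ENNReal

noncomputable section

namespace RangeCapacity

section Growth

variable {G : Type*} [Group G]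

/-- The word length of `g` with respect to `Γ`: the least `m` such that `g` is a product of `m`
elements of `Γ`. (It is used only when `Γ` is a symmetric generating set, so that the infimum is
over a non-empty set.) -/
def wordLength (Γ : Finset G) (g : G) : ℕ :=
  sInf {m : ℕ | ∃ l : List G, l.length = m ∧ (∀ γ ∈ l, γ ∈ Γ) ∧ l.prod = g}

/-- The growth function: the number of group elements of word length at most `n`. -/
def growth (Γ : Finset G) (n : ℕ) : ℕ :=
  Set.ncard {g : G | wordLength Γ g ≤ n}

/-- `f ≲ g`: there is a constant `c > 0` with `f n ≤ c * g n` for all positive integers `n`. -/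
def AsympLE (f g : ℕ → ℝ) : Prop :=
  ∃ c : ℝ, 0 < c ∧ ∀ n : ℕ, 1 ≤ n → f n ≤ c * g n

/-- `d` is the growth index of the group generated by `Γ`: for finite `d` the growth function is
comparable to `n ^ d`; for `d = ∞` it dominates every power of `n`. -/
def HasGrowthIndex (Γ : Finset G) (d : ℕ∞) : Prop :=
  (∀ k : ℕ, d = (k : ℕ∞) →
    AsympLE (fun n => (growth Γ n : ℝ)) (fun n => (n : ℝ) ^ k) ∧
      AsympLE (fun n => (n : ℝ) ^ k) (fun n => (growth Γ n : ℝ))) ∧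
  (d = ⊤ → ∀ k : ℕ, AsympLE (fun n => (n : ℝ) ^ k) (fun n => (growth Γ n : ℝ)))

end Growth

section Walk

variable {G Ω : Type*} [Group G]

/-- The walk with steps `X 0, X 1, …` started at `g`: after `n` steps it is at
`g * X 0 * ⋯ * X (n - 1)`. -/
def walk (X : ℕ → Ω → G) (g : G) : ℕ → Ω → G
  | 0, _ => g
  | n + 1, ω => walk X g n ω * X n ω

/-- The range up to time `n` of the walk started at the identity. -/
def walkRange (X : ℕ → Ω → G) (n : ℕ) (ω : Ω) : Set G :=
  {g : G | ∃ k : ℕ, k ≤ n ∧ walk X 1 k ω = g}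

/-- The first return time `inf {n ≥ 1 : S n ∈ A}` to `A` of the walk started at `g`; it is `⊤`
if the walk does not visit `A` at any positive time. -/
def returnTime (X : ℕ → Ω → G) (g : G) (A : Set G) (ω : Ω) : ℕ∞ :=
  ⨅ (n : ℕ) (_ : 1 ≤ n ∧ walk X g n ω ∈ A), (n : ℕ∞)

variable [MeasurableSpace Ω]

/-- The capacity of `A`: the sum over `g ∈ A` of the probability that the walk started at `g`
never returns to `A`. -/
def cap (P : Measure Ω) (X : ℕ → Ω → G) (A : Set G) : ℝ≥0∞ :=
  ∑' g : A, P {ω | returnTime X (g : G) A ω = ⊤}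

/-- The random variable `C n`: the capacity of the range up to time `n`, which is finite since the
range is a finite set. The probability inside `cap` is taken over a fresh copy of the walk. -/
def capRange (P : Measure Ω) (X : ℕ → Ω → G) (n : ℕ) (ω : Ω) : ℝ :=
  (cap P X (walkRange X n ω)).toReal

end Walk

end RangeCapacity

end

/-! The capacity of the range is nearly additive in time. Cutting the walk at time `n` writes the
range up to `n + m` as the range up to `n` together with a left translate of the range of the
shifted walk. Capacity is invariant under left translation, so C(n+m) = C(n) + C'(m) + D, where
C'(m) is independent of C(n) and has the law of C(m). Capacity is subadditive, and its defect of
additivity on `A` and `B` is at most three times the sum of the Green function over A × B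
(`cap_add_cap_le`); hence |D| is at most three times `greenSum`.

It remains to see that D is small in L². Growth of degree at least six enters only through the heat
kernel bound p_n ≤ M/(n+1)³ (`exists_heatKernel_le`), which comes from a Nash-type inequality:
translating p_n by an element of a ball costs little in ℓ² when the return probability decreases
slowly. Summing gives Green tails of order a⁻². In the second moment of `greenSum` any two time
intervals contain the time `n`; averaging over the steps that they do not share turns Green
functions into tails, and the bounds sum to a power of a logarithm (`lintegral_greenSum_sq_le`). The
cruder bound (n+m)^(1/2) is enough.

By Cauchy–Schwarz the variances satisfy `exists_variance_recursion`. That recursion first forces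
linear growth; its error is then of order (n+m)^(3/4), and an almost subadditive Fekete argument
gives the limit (`exists_tendsto_div_of_sqrt_recursion`). -/

namespace RangeCapacity

set_option linter.unusedSectionVars false

/-! ### Averaging operators and the heat kernel, over ℝ (for differences) and ℝ≥0∞ (for infinite
sums) at once. -/

section Averages

variable {G : Type*} [Group G] {K : Type*} [CommSemiring K] [Inv K]

/-- Average of `f` over the right translates of `x` by elements of `Γ`. -/
noncomputable def avgR (Γ : Finset G) (f : G → K) (x : G) : K :=
  (Γ.card : K)⁻¹ * ∑ γ ∈ Γ, f (x * γ)

/-- Average of `f` over the left translates of `x` by elements of `Γ`. -/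
noncomputable def avgL (Γ : Finset G) (f : G → K) (x : G) : K :=
  (Γ.card : K)⁻¹ * ∑ γ ∈ Γ, f (γ * x)

/-- The `n`-step transition probability from the identity. -/
noncomputable def heatKernel (K : Type*) [CommSemiring K] [Inv K] (Γ : Finset G) (n : ℕ) : G → K :=
  (avgR Γ)^[n] (Set.indicator {1} 1)

lemma avgL_avgR_comm (Γ : Finset G) : Function.Commute (avgL (K := K) Γ) (avgR Γ) := by
  intro f
  ext x
  simp only [avgL, avgR, ← Finset.mul_sum]
  rw [Finset.sum_comm]
  simp only [mul_assoc]

lemma heatKernel_zero (Γ : Finset G) : heatKernel K Γ 0 = Set.indicator {1} 1 := rfl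

lemma heatKernel_succ (Γ : Finset G) (n : ℕ) :
    heatKernel K Γ (n + 1) = avgR Γ (heatKernel K Γ n) :=
  Function.iterate_succ_apply' _ _ _

lemma avgL_indicator_one (Γ : Finset G) :
    avgL (K := K) Γ (Set.indicator {1} 1) = avgR Γ (Set.indicator {1} 1) := by
  classical
  ext x
  simp only [avgL, avgR, Set.indicator_apply, Set.mem_singleton_iff, Pi.one_apply]
  congr 1
  exact Finset.sum_congr rfl fun γ _ => by rw [mul_eq_one_comm]

/-- Left and right averages commute and agree on the point mass at the identity, so a step may be
added on either side. -/
lemma avgL_heatKernel (Γ : Finset G) (n : ℕ) :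
    avgL Γ (heatKernel K Γ n) = heatKernel K Γ (n + 1) := by
  rw [heatKernel, ((avgL_avgR_comm Γ).iterate_right n).eq, avgL_indicator_one, heatKernel,
    Function.iterate_succ_apply]

lemma heatKernel_inv {Γ : Finset G} (hsymm : ∀ γ ∈ Γ, γ⁻¹ ∈ Γ) (n : ℕ) (x : G) :
    heatKernel K Γ n x⁻¹ = heatKernel K Γ n x := by
  induction n generalizing x with
  | zero =>
    classical
    simp [heatKernel_zero, Set.indicator_apply]
  | succ n ih =>
    conv_lhs => rw [← avgL_heatKernel, avgL]
    rw [heatKernel_succ, avgR]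
    congr 1
    refine Finset.sum_nbij' (fun γ => γ⁻¹) (fun γ => γ⁻¹) hsymm hsymm (by simp) (by simp) ?_
    intro γ _
    rw [← ih]
    congr 1
    group

end Averages

/-! ### The ℓ² geometry of the heat kernel. -/

section HeatKernelReal

variable {G : Type*} [Group G] {Γ : Finset G}

lemma heatKernel_nonneg (n : ℕ) (x : G) : 0 ≤ heatKernel ℝ Γ n x := by
  induction n generalizing x with
  | zero =>
    classical
    rw [heatKernel_zero, Set.indicator_apply]
    split_ifs <;> simp
  | succ n ih =>
    rw [heatKernel_succ, avgR]
    exact mul_nonneg (by positivity) (Finset.sum_nonneg fun γ _ => ih _)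

lemma heatKernel_support_finite (n : ℕ) : (Function.support (heatKernel ℝ Γ n)).Finite := by
  induction n with
  | zero =>
    rw [heatKernel_zero]
    exact (Set.finite_singleton 1).subset Set.support_indicator_subset
  | succ n ih =>
    refine ((Γ.finite_toSet).biUnion fun γ _ => ih.image fun x => x * γ⁻¹).subset ?_
    intro x hx
    rw [Function.mem_support, heatKernel_succ, avgR] at hx
    obtain ⟨γ, hγ, h⟩ := Finset.exists_ne_zero_of_sum_ne_zero (right_ne_zero_of_mul hx)
    simp only [Set.mem_iUnion, Set.mem_image]
    exact ⟨γ, hγ, x * γ, h, by group⟩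

lemma summable_heatKernel_mul (n : ℕ) (f : G → ℝ) :
    Summable fun x => heatKernel ℝ Γ n x * f x :=
  summable_of_hasFiniteSupport ((heatKernel_support_finite n).subset
    (Function.support_mul_subset_left _ _))

/-- Chapman–Kolmogorov; symmetry of `Γ` allows the convolution to be written as a correlation. -/
lemma tsum_heatKernel_mul (hsymm : ∀ γ ∈ Γ, γ⁻¹ ∈ Γ) (n m : ℕ) (y : G) :
    ∑' x, heatKernel ℝ Γ n x * heatKernel ℝ Γ m (x * y) = heatKernel ℝ Γ (n + m) y := by
  classical
  induction n generalizing y with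
  | zero =>
    rw [tsum_eq_single 1]
    · simp [heatKernel_zero]
    · intro x hx
      simp [heatKernel_zero, hx]
  | succ n ih =>
    have h1 : ∀ γ : G, ∑' x, heatKernel ℝ Γ n (x * γ) * heatKernel ℝ Γ m (x * y)
        = heatKernel ℝ Γ (n + m) (γ⁻¹ * y) := by
      intro γ
      rw [← ih, ← (Equiv.mulRight γ).tsum_eq fun x =>
        heatKernel ℝ Γ n x * heatKernel ℝ Γ m (x * (γ⁻¹ * y))]
      simp [mul_assoc]
    have h2 : ∀ γ : G, Summable fun x => heatKernel ℝ Γ n (x * γ) * heatKernel ℝ Γ m (x * y) := by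
      intro γ
      rw [← (Equiv.mulRight γ⁻¹).summable_iff]
      simpa [Function.comp_def, mul_assoc] using
        summable_heatKernel_mul n fun x => heatKernel ℝ Γ m (x * (γ⁻¹ * y))
    rw [show n + 1 + m = n + m + 1 by ring, ← avgL_heatKernel (n := n + m), avgL]
    simp_rw [heatKernel_succ, avgR, mul_assoc, Finset.sum_mul]
    rw [tsum_mul_left, Summable.tsum_finsetSum fun γ _ => h2 γ]
    congr 1
    simp_rw [h1]
    exact Finset.sum_nbij' (fun γ => γ⁻¹) (fun γ => γ⁻¹) hsymm hsymm (by simp) (by simp) (by simp)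

lemma tsum_heatKernel (hΓ : Γ.Nonempty) (n : ℕ) : ∑' x, heatKernel ℝ Γ n x = 1 := by
  classical
  induction n with
  | zero =>
    rw [tsum_eq_single 1]
    · simp [heatKernel_zero]
    · intro x hx
      simp [heatKernel_zero, hx]
  | succ n ih =>
    have hs : Summable (heatKernel ℝ Γ n) :=
      summable_of_hasFiniteSupport (heatKernel_support_finite n)
    have h2 : ∀ γ : G, Summable fun x => heatKernel ℝ Γ n (x * γ) := fun γ =>
      (Equiv.mulRight γ).summable_iff.2 hs
    have h1 : ∀ γ : G, ∑' x, heatKernel ℝ Γ n (x * γ) = 1 := fun γ =>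
      ((Equiv.mulRight γ).tsum_eq (heatKernel ℝ Γ n)).trans ih
    simp_rw [heatKernel_succ, avgR]
    rw [tsum_mul_left, Summable.tsum_finsetSum fun γ _ => h2 γ]
    simp [h1, hΓ.ne_empty]

lemma sum_heatKernel_le_one (hΓ : Γ.Nonempty) (n : ℕ) (s : Finset G) :
    ∑ x ∈ s, heatKernel ℝ Γ n x ≤ 1 := by
  rw [← tsum_heatKernel hΓ n]
  exact (summable_of_hasFiniteSupport (heatKernel_support_finite n)).sum_le_tsum s
    fun x _ => heatKernel_nonneg n x

lemma summable_heatKernel_sq (n : ℕ) (y z : G) :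
    Summable fun x => (heatKernel ℝ Γ n (x * y) - heatKernel ℝ Γ n (x * z)) ^ 2 := by
  have hf := heatKernel_support_finite (Γ := Γ) n
  refine summable_of_hasFiniteSupport (((hf.image fun x => x * y⁻¹).union
    (hf.image fun x => x * z⁻¹)).subset ?_)
  intro x hx
  rw [Function.mem_support] at hx
  by_cases h : heatKernel ℝ Γ n (x * y) = 0
  · right
    exact ⟨x * z, fun h' => hx (by simp [h, h']), by group⟩
  · left
    exact ⟨x * y, h, by group⟩

/-- The decrement of the even-time heat kernel away from the identity. -/
noncomputable def defect (Γ : Finset G) (n : ℕ) (y : G) : ℝ :=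
  heatKernel ℝ Γ (n + n) 1 - heatKernel ℝ Γ (n + n) y

/-- Expanding the square and applying Chapman–Kolmogorov makes `defect` half a squared ℓ² distance
between translates of p_n. Hence it is nonnegative and its square root is subadditive. -/
lemma tsum_sub_sq_eq_defect (hsymm : ∀ γ ∈ Γ, γ⁻¹ ∈ Γ) (n : ℕ) (y z : G) :
    ∑' x, (heatKernel ℝ Γ n (x * y) - heatKernel ℝ Γ n (x * z)) ^ 2
      = 2 * defect Γ n (y⁻¹ * z) := by
  have key : ∀ y : G, ∑' x, (heatKernel ℝ Γ n x - heatKernel ℝ Γ n (x * y)) ^ 2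
      = 2 * defect Γ n y := by
    intro y
    have h1 : ∀ x, (heatKernel ℝ Γ n x - heatKernel ℝ Γ n (x * y)) ^ 2
        = heatKernel ℝ Γ n x * heatKernel ℝ Γ n (x * 1)
          + heatKernel ℝ Γ n (x * y) * heatKernel ℝ Γ n (x * y)
          - 2 * (heatKernel ℝ Γ n x * heatKernel ℝ Γ n (x * y)) := fun x => by
      rw [mul_one]; ring
    have s1 := summable_heatKernel_mul (Γ := Γ) n fun x => heatKernel ℝ Γ n (x * 1)
    have s0 := summable_heatKernel_mul (Γ := Γ) n fun x => heatKernel ℝ Γ n x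
    have s2 : Summable fun x => heatKernel ℝ Γ n (x * y) * heatKernel ℝ Γ n (x * y) :=
      (Equiv.mulRight y).summable_iff.2 s0
    have s3 := (summable_heatKernel_mul (Γ := Γ) n fun x => heatKernel ℝ Γ n (x * y)).mul_left 2
    have e2 : ∑' x, heatKernel ℝ Γ n (x * y) * heatKernel ℝ Γ n (x * y)
        = heatKernel ℝ Γ (n + n) 1 := by
      rw [← tsum_heatKernel_mul hsymm, ← (Equiv.mulRight y).tsum_eq fun x =>
        heatKernel ℝ Γ n x * heatKernel ℝ Γ n (x * 1)]
      simp
    simp_rw [h1]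
    rw [(s1.add s2).tsum_sub s3, s1.tsum_add s2, e2, tsum_mul_left,
      tsum_heatKernel_mul hsymm, tsum_heatKernel_mul hsymm, defect]
    ring
  rw [← key, ← (Equiv.mulRight y).tsum_eq fun x =>
    (heatKernel ℝ Γ n x - heatKernel ℝ Γ n (x * (y⁻¹ * z))) ^ 2]
  simp [mul_assoc]

lemma defect_nonneg (hsymm : ∀ γ ∈ Γ, γ⁻¹ ∈ Γ) (n : ℕ) (y : G) : 0 ≤ defect Γ n y := by
  have h := tsum_sub_sq_eq_defect hsymm n 1 y
  have h2 : 0 ≤ ∑' x, (heatKernel ℝ Γ n (x * 1) - heatKernel ℝ Γ n (x * y)) ^ 2 :=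
    tsum_nonneg fun x => sq_nonneg _
  rw [h, inv_one, one_mul] at h2
  linarith

/-- The ℓ² triangle inequality in squared form, with the Young weight `t` left free. -/
lemma defect_mul_le (hsymm : ∀ γ ∈ Γ, γ⁻¹ ∈ Γ) (n : ℕ) (y z : G) {t : ℝ} (ht : 0 < t) :
    defect Γ n (y * z) ≤ (1 + t⁻¹) * defect Γ n y + (1 + t) * defect Γ n z := by
  have s1 := summable_heatKernel_sq (Γ := Γ) n 1 y
  have s2 := summable_heatKernel_sq (Γ := Γ) n y (y * z)
  have h : ∑' x, (heatKernel ℝ Γ n (x * 1) - heatKernel ℝ Γ n (x * (y * z))) ^ 2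
      ≤ ∑' x, ((1 + t⁻¹) * (heatKernel ℝ Γ n (x * 1) - heatKernel ℝ Γ n (x * y)) ^ 2
        + (1 + t) * (heatKernel ℝ Γ n (x * y) - heatKernel ℝ Γ n (x * (y * z))) ^ 2) := by
    refine (summable_heatKernel_sq n 1 (y * z)).tsum_le_tsum (fun x => ?_)
      ((s1.mul_left _).add (s2.mul_left _))
    set a := heatKernel ℝ Γ n (x * 1) - heatKernel ℝ Γ n (x * y)
    set b := heatKernel ℝ Γ n (x * y) - heatKernel ℝ Γ n (x * (y * z))
    have hab : heatKernel ℝ Γ n (x * 1) - heatKernel ℝ Γ n (x * (y * z)) = a + b := by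
      simp [a, b]
    rw [hab]
    have h0 : (1 + t⁻¹) * a ^ 2 + (1 + t) * b ^ 2 - (a + b) ^ 2 = t⁻¹ * (a - t * b) ^ 2 := by
      field_simp
      ring
    have : 0 ≤ t⁻¹ * (a - t * b) ^ 2 := by positivity
    linarith
  rw [(s1.mul_left _).tsum_add (s2.mul_left _), tsum_mul_left, tsum_mul_left,
    tsum_sub_sq_eq_defect hsymm, tsum_sub_sq_eq_defect hsymm, tsum_sub_sq_eq_defect hsymm] at h
  simp only [inv_one, one_mul, inv_mul_cancel_left] at h
  linarith

end HeatKernelReal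

/-! ### Cubic decay of the heat kernel from growth of degree six. -/

section Decay

variable {G : Type*} [Group G] {Γ : Finset G}

-- Subadditivity of the square root of `defect` along a product of `r` factors; the weight t = r
-- gives (1 + 1/r) r² + (1 + r) = (r + 1)².
open scoped Pointwise in
open Classical in
lemma defect_le_of_mem_pow (hsymm : ∀ γ ∈ Γ, γ⁻¹ ∈ Γ) (n r : ℕ) {S : Finset G} {D : ℝ}
    (hD : ∀ y ∈ S, defect Γ n y ≤ D) {y : G} (hy : y ∈ S ^ r) :
    defect Γ n y ≤ (r : ℝ) ^ 2 * D := by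
  induction r generalizing y with
  | zero =>
    rw [pow_zero, Finset.mem_one] at hy
    simp [hy, defect]
  | succ r ih =>
    rcases Nat.eq_zero_or_pos r with rfl | hr
    · simpa using hD y (by simpa using hy)
    rw [pow_succ, Finset.mem_mul] at hy
    obtain ⟨a, ha, b, hb, rfl⟩ := hy
    have hr' : (0 : ℝ) < r := by exact_mod_cast hr
    have h1 := defect_mul_le hsymm n a b hr'
    have h2 : (1 + (r : ℝ)⁻¹) * defect Γ n a ≤ (1 + (r : ℝ)⁻¹) * ((r : ℝ) ^ 2 * D) :=
      mul_le_mul_of_nonneg_left (ih ha) (by positivity)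
    have h3 : (1 + (r : ℝ)) * defect Γ n b ≤ (1 + r) * D :=
      mul_le_mul_of_nonneg_left (hD b hb) (by positivity)
    have h4 : (1 + (r : ℝ)⁻¹) * ((r : ℝ) ^ 2 * D) + (1 + r) * D = ((r : ℝ) + 1) ^ 2 * D := by
      field_simp
      ring
    push_cast
    linarith

/-- The loss of the return probability over two steps. -/
noncomputable def returnLoss (Γ : Finset G) (n : ℕ) : ℝ :=
  heatKernel ℝ Γ (n + n) 1 - heatKernel ℝ Γ (n + 1 + (n + 1)) 1

lemma returnLoss_eq (hΓ : Γ.Nonempty) (n : ℕ) :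
    returnLoss Γ n = (Γ.card : ℝ)⁻¹ * ((Γ.card : ℝ)⁻¹ *
      ∑ γ ∈ Γ, ∑ γ' ∈ Γ, defect Γ n (γ * γ')) := by
  have hc : (Γ.card : ℝ) ≠ 0 := by simp [hΓ.ne_empty]
  rw [returnLoss, show n + 1 + (n + 1) = n + n + 1 + 1 by ring, heatKernel_succ, avgR]
  simp only [heatKernel_succ, avgR, defect, Finset.sum_sub_distrib, one_mul, Finset.sum_const,
    nsmul_eq_mul, ← Finset.mul_sum]
  field_simp

lemma returnLoss_nonneg (hsymm : ∀ γ ∈ Γ, γ⁻¹ ∈ Γ) (hΓ : Γ.Nonempty) (n : ℕ) :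
    0 ≤ returnLoss Γ n := by
  rw [returnLoss_eq hΓ]
  have : 0 ≤ ∑ γ ∈ Γ, ∑ γ' ∈ Γ, defect Γ n (γ * γ') :=
    Finset.sum_nonneg fun γ _ => Finset.sum_nonneg fun γ' _ => defect_nonneg hsymm n _
  positivity

lemma defect_mul_le_returnLoss (hsymm : ∀ γ ∈ Γ, γ⁻¹ ∈ Γ) (n : ℕ) {a b : G} (ha : a ∈ Γ)
    (hb : b ∈ Γ) : defect Γ n (a * b) ≤ (Γ.card : ℝ) ^ 2 * returnLoss Γ n := by
  have hΓ : Γ.Nonempty := ⟨a, ha⟩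
  have hc : (Γ.card : ℝ) ≠ 0 := by simp [hΓ.ne_empty]
  have h1 : defect Γ n (a * b) ≤ ∑ γ' ∈ Γ, defect Γ n (a * γ') :=
    Finset.single_le_sum (f := fun γ' => defect Γ n (a * γ'))
      (fun γ' _ => defect_nonneg hsymm n _) hb
  have h2 : ∑ γ' ∈ Γ, defect Γ n (a * γ') ≤ ∑ γ ∈ Γ, ∑ γ' ∈ Γ, defect Γ n (γ * γ') :=
    Finset.single_le_sum (f := fun γ => ∑ γ' ∈ Γ, defect Γ n (γ * γ'))
      (fun γ _ => Finset.sum_nonneg fun γ' _ => defect_nonneg hsymm n _) ha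
  rw [returnLoss_eq hΓ]
  field_simp
  linarith

-- The Nash-type inequality: p_{2n}(1) exceeds p_{2n}(y) by at most r² |Γ|² `returnLoss` for `y` in
-- (Γ²)^r, and averaging p_{2n} over that set gives at most the inverse of its size. Only even words
-- are used, so a periodic walk causes no trouble.
open scoped Pointwise in
open Classical in
lemma heatKernel_one_le (hsymm : ∀ γ ∈ Γ, γ⁻¹ ∈ Γ) (hΓ : Γ.Nonempty) (n r : ℕ) :
    heatKernel ℝ Γ (n + n) 1 ≤ (r : ℝ) ^ 2 * ((Γ.card : ℝ) ^ 2 * returnLoss Γ n)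
      + (((Γ ^ (2 * r)).card : ℝ))⁻¹ := by
  set B := Γ ^ (2 * r) with hB
  have hBne : B.Nonempty := hΓ.pow
  have hBc : (0 : ℝ) < B.card := by exact_mod_cast hBne.card_pos
  have h1 : ∀ y ∈ B, heatKernel ℝ Γ (n + n) 1 ≤ (r : ℝ) ^ 2 * ((Γ.card : ℝ) ^ 2 * returnLoss Γ n)
      + heatKernel ℝ Γ (n + n) y := by
    intro y hy
    rw [hB, pow_mul] at hy
    have := defect_le_of_mem_pow hsymm n r (S := Γ ^ 2)
      (D := (Γ.card : ℝ) ^ 2 * returnLoss Γ n) (fun z hz => by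
        rw [pow_two, Finset.mem_mul] at hz
        obtain ⟨a, ha, b, hb, rfl⟩ := hz
        exact defect_mul_le_returnLoss hsymm n ha hb) hy
    rw [defect] at this
    linarith
  have h2 := Finset.sum_le_sum h1
  rw [Finset.sum_add_distrib, Finset.sum_const, Finset.sum_const, nsmul_eq_mul, nsmul_eq_mul] at h2
  have h3 := sum_heatKernel_le_one hΓ (n + n) B
  have h4 : (B.card : ℝ) * heatKernel ℝ Γ (n + n) 1 ≤ B.card *
      ((r : ℝ) ^ 2 * ((Γ.card : ℝ) ^ 2 * returnLoss Γ n) + (B.card : ℝ)⁻¹) := by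
    rw [mul_add, mul_inv_cancel₀ hBc.ne']
    linarith
  exact le_of_mul_le_mul_left h4 hBc

lemma exists_list_of_closure_eq_top (hsymm : ∀ γ ∈ Γ, γ⁻¹ ∈ Γ)
    (hgen : Subgroup.closure (Γ : Set G) = ⊤) (x : G) :
    ∃ l : List G, (∀ γ ∈ l, γ ∈ Γ) ∧ l.prod = x := by
  have hx : x ∈ (Subgroup.closure (Γ : Set G)).toSubmonoid := by rw [hgen]; trivial
  rw [Subgroup.closure_toSubmonoid] at hx
  obtain ⟨l, hl, h⟩ := Submonoid.exists_list_of_mem_closure hx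
  refine ⟨l, fun γ hγ => ?_, h⟩
  rcases hl γ hγ with h | h
  · exact h
  · simpa using hsymm _ h

open scoped Pointwise in
open Classical in
lemma list_prod_mem_pow (l : List G) (hl : ∀ γ ∈ l, γ ∈ Γ) : l.prod ∈ Γ ^ l.length := by
  induction l with
  | nil => simp
  | cons a l ih =>
    rw [List.prod_cons, List.length_cons, pow_succ']
    exact Finset.mul_mem_mul (hl a (by simp)) (ih fun γ hγ => hl γ (by simp [hγ]))

open scoped Pointwise in
open Classical in
lemma pow_subset_pow_add_two (hsymm : ∀ γ ∈ Γ, γ⁻¹ ∈ Γ) (hΓ : Γ.Nonempty) (m k : ℕ) :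
    Γ ^ m ⊆ Γ ^ (m + 2 * k) := by
  obtain ⟨γ, hγ⟩ := hΓ
  have h1 : (1 : G) ∈ (Γ ^ 2) ^ k := by
    apply Finset.one_mem_pow
    rw [pow_two]
    simpa using Finset.mul_mem_mul hγ (hsymm γ hγ)
  intro x hx
  rw [pow_add, pow_mul]
  simpa using Finset.mul_mem_mul hx h1

-- Even-length words fill at least half of the ball: an element of odd length becomes even after
-- multiplication by one fixed generator, and shorter even words are padded by γγ⁻¹.
open scoped Pointwise in
open Classical in
lemma growth_two_mul_le (hsymm : ∀ γ ∈ Γ, γ⁻¹ ∈ Γ) (hΓ : Γ.Nonempty)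
    (hgen : Subgroup.closure (Γ : Set G) = ⊤) (r : ℕ) :
    growth Γ (2 * r) ≤ 2 * (Γ ^ (2 * r)).card := by
  obtain ⟨c, hc⟩ := hΓ
  set B := Γ ^ (2 * r) with hB
  have hsub : {g : G | wordLength Γ g ≤ 2 * r} ⊆ ((B ∪ B.image (· * c⁻¹) : Finset G) : Set G) := by
    intro x hx
    have hne : {m : ℕ | ∃ l : List G, l.length = m ∧ (∀ γ ∈ l, γ ∈ Γ) ∧ l.prod = x}.Nonempty := by
      obtain ⟨l, hl, h⟩ := exists_list_of_closure_eq_top hsymm hgen x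
      exact ⟨_, l, rfl, hl, h⟩
    obtain ⟨l, hlen, hl, rfl⟩ := Nat.sInf_mem hne
    have hle : l.length ≤ 2 * r := hlen.le.trans hx
    have hmem := list_prod_mem_pow l hl
    simp only [Finset.coe_union, Finset.coe_image, Set.mem_union, Finset.mem_coe, Set.mem_image]
    rcases Nat.even_or_odd' l.length with ⟨k, hk | hk⟩
    · left
      have := pow_subset_pow_add_two hsymm ⟨c, hc⟩ l.length (r - k) hmem
      rwa [show l.length + 2 * (r - k) = 2 * r by omega] at this
    · right
      refine ⟨l.prod * c, ?_, by group⟩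
      have h2 : l.prod * c ∈ Γ ^ (l.length + 1) := by
        rw [pow_succ]
        exact Finset.mul_mem_mul hmem hc
      have := pow_subset_pow_add_two hsymm ⟨c, hc⟩ (l.length + 1) (r - k - 1) h2
      rwa [show l.length + 1 + 2 * (r - k - 1) = 2 * r by omega] at this
  calc growth Γ (2 * r) ≤ (B ∪ B.image (· * c⁻¹)).card := by
        rw [growth, ← Set.ncard_coe_finset]
        exact Set.ncard_le_ncard hsub (Finset.finite_toSet _)
    _ ≤ B.card + (B.image (· * c⁻¹)).card := Finset.card_union_le _ _
    _ ≤ 2 * B.card := by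
        have := Finset.card_image_le (s := B) (f := (· * c⁻¹))
        omega

lemma exists_pow_six_le_growth {d : ℕ∞} (h : HasGrowthIndex Γ d) (hd : 6 ≤ d) :
    ∃ c : ℝ, 0 < c ∧ ∀ n : ℕ, 1 ≤ n → (n : ℝ) ^ 6 ≤ c * growth Γ n := by
  rcases eq_or_ne d ⊤ with rfl | hd'
  · exact h.2 rfl 6
  · lift d to ℕ using hd'
    obtain ⟨c, hc, hn⟩ := (h.1 d rfl).2
    refine ⟨c, hc, fun n h1 => le_trans ?_ (hn n h1)⟩
    exact pow_le_pow_right₀ (by exact_mod_cast h1) (by exact_mod_cast hd)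

/-- A Nash-type inequality for a sequence forces cubic decay. -/
lemma exists_le_div_cube {u : ℕ → ℝ} (hu1 : ∀ n, u n ≤ 1) (hu : ∀ n, u (n + 1) ≤ u n)
    {Q c : ℝ} (hQ : 0 < Q) (hc : 0 < c)
    (h : ∀ n r : ℕ, 1 ≤ r → u n ≤ Q * (r : ℝ) ^ 2 * (u n - u (n + 1)) + c / (r : ℝ) ^ 6) :
    ∃ M : ℝ, 0 < M ∧ ∀ n : ℕ, u n ≤ M / ((n : ℝ) + 1) ^ 3 := by
  set A : ℝ := 6 * Q + 1 with hA
  have hA1 : 1 < A := by rw [hA]; linarith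
  -- The first entry makes the claim trivial while n + 1 ≤ A; the second makes the term c / r⁶ at
  -- most half of M / N³.
  set M : ℝ := max (A ^ 3) (2 * c * (4 * A) ^ 3) with hM
  have hMpos : 0 < M := lt_max_of_lt_left (by positivity)
  refine ⟨M, hMpos, fun n => ?_⟩
  induction n with
  | zero =>
    refine (hu1 0).trans ?_
    have : 1 ≤ A ^ 3 := one_le_pow₀ hA1.le
    have h2 : 1 ≤ M := this.trans (le_max_left _ _)
    simpa using h2
  | succ n ih =>
    push_cast
    set N : ℝ := (n : ℝ) + 1 + 1 with hN
    have hn0 : (0 : ℝ) ≤ n := Nat.cast_nonneg n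
    have hNpos : 0 < N := by rw [hN]; linarith
    rcases lt_or_ge N A with hNA | hNA
    · refine (hu1 _).trans ?_
      rw [le_div_iff₀ (by positivity), one_mul]
      exact (pow_le_pow_left₀ hNpos.le hNA.le 3).trans (le_max_left _ _)
    by_contra! hcon
    have hun : M / N ^ 3 < u n := hcon.trans_le (hu n)
    -- The radius r = ⌊√(N/A)⌋ balances the two terms: large enough for c / r⁶ to be absorbed in
    -- half of `u n`, small enough that 6Qr² ≤ N.
    set s : ℝ := √(N / A) with hs
    have hs2 : s ^ 2 = N / A := Real.sq_sqrt (by positivity)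
    have hs1 : 1 ≤ s := by
      rw [hs, Real.one_le_sqrt, le_div_iff₀ (by positivity)]
      linarith
    set r := ⌊s⌋₊ with hr
    have hr1 : 1 ≤ r := Nat.le_floor (by simpa using hs1)
    have hr1' : (1 : ℝ) ≤ r := by exact_mod_cast hr1
    have hrs : (r : ℝ) ≤ s := Nat.floor_le (by positivity)
    have hsr : s ≤ 2 * r := by
      have := Nat.lt_floor_add_one s
      rw [← hr] at this
      linarith
    have hr2 : A * (r : ℝ) ^ 2 ≤ N := by
      have := pow_le_pow_left₀ (by positivity) hrs 2
      rw [hs2, le_div_iff₀ (by positivity)] at this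
      linarith
    have hr2' : N ≤ 4 * A * (r : ℝ) ^ 2 := by
      have := pow_le_pow_left₀ (by positivity) hsr 2
      rw [hs2, div_le_iff₀ (by positivity)] at this
      linarith
    have hr6 : c / (r : ℝ) ^ 6 ≤ M / N ^ 3 / 2 := by
      rw [div_div, div_le_div_iff₀ (by positivity) (by positivity)]
      have h1 := pow_le_pow_left₀ hNpos.le hr2' 3
      have h2 : 2 * c * (4 * A) ^ 3 ≤ M := le_max_right _ _
      calc c * (N ^ 3 * 2) ≤ c * ((4 * A * (r : ℝ) ^ 2) ^ 3 * 2) := by gcongr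
        _ = 2 * c * (4 * A) ^ 3 * (r : ℝ) ^ 6 := by ring
        _ ≤ M * (r : ℝ) ^ 6 := by gcongr
    have hmain := h n r hr1
    have hdrop : u n ≤ 2 * Q * (r : ℝ) ^ 2 * (u n - u (n + 1)) := by nlinarith
    have hunpos : 0 < u n := lt_trans (by positivity) hun
    have hdiff : 0 ≤ u n - u (n + 1) := by linarith [hu n]
    have h3 : 3 * u n ≤ N * (u n - u (n + 1)) := by
      have h6 : 6 * Q * (r : ℝ) ^ 2 ≤ N := by
        refine le_trans ?_ hr2
        gcongr
        rw [hA]; linarith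
      have := mul_le_mul_of_nonneg_right h6 hdiff
      linarith
    have hN1 : 0 < (n : ℝ) + 1 := by positivity
    rw [le_div_iff₀ (by positivity)] at ih
    rw [div_lt_iff₀ (by positivity)] at hcon
    have h4 : N * u (n + 1) ≤ (N - 3) * u n := by linarith
    have h5 : N ^ 3 * u (n + 1) ≤ u n * ((n : ℝ) + 1) ^ 3 := by
      have e : N ^ 3 * u (n + 1) = N ^ 2 * (N * u (n + 1)) := by ring
      have e2 : (n : ℝ) + 1 = N - 1 := by rw [hN]; ring
      rw [e, e2]
      have h6 : N ^ 2 * (N * u (n + 1)) ≤ N ^ 2 * ((N - 3) * u n) := by gcongr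
      -- A relative drop of 3/N per step is what cubic decay requires; the difference of the two
      -- sides is 3N - 1.
      have h7 : N ^ 2 * (N - 3) ≤ (N - 1) ^ 3 := by nlinarith
      have h8 := mul_le_mul_of_nonneg_left h7 hunpos.le
      linarith
    linarith

lemma heatKernel_even_le (hsymm : ∀ γ ∈ Γ, γ⁻¹ ∈ Γ) (n : ℕ) (x : G) :
    heatKernel ℝ Γ (n + n) x ≤ heatKernel ℝ Γ (n + n) 1 := by
  have := defect_nonneg hsymm n x
  rw [defect] at this
  linarith

open scoped Pointwise in
/-- Uniform decay of the heat kernel from a growth lower bound of degree six. -/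
theorem exists_heatKernel_le (hsymm : ∀ γ ∈ Γ, γ⁻¹ ∈ Γ) (hΓ : Γ.Nonempty)
    (hgen : Subgroup.closure (Γ : Set G) = ⊤) {c : ℝ} (hc : 0 < c)
    (hgr : ∀ n : ℕ, 1 ≤ n → (n : ℝ) ^ 6 ≤ c * growth Γ n) :
    ∃ M : ℝ, 0 < M ∧ ∀ n x, heatKernel ℝ Γ n x ≤ M / ((n : ℝ) + 1) ^ 3 := by
  classical
  have hcard : (0 : ℝ) < Γ.card := by exact_mod_cast hΓ.card_pos
  obtain ⟨M, hM, hb⟩ := exists_le_div_cube (u := fun n => heatKernel ℝ Γ (n + n) 1)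
    (Q := (Γ.card : ℝ) ^ 2) (c := c)
    (fun n => by simpa using sum_heatKernel_le_one hΓ (n + n) {1})
    (fun n => by
      have := returnLoss_nonneg hsymm hΓ n
      rw [returnLoss] at this
      linarith) (by positivity) hc (fun n r hr => by
      have h1 := heatKernel_one_le hsymm hΓ n r
      rw [returnLoss] at h1
      have hr0 : (0 : ℝ) < r := by exact_mod_cast hr
      have h2 : (growth Γ (2 * r) : ℝ) ≤ 2 * (Γ ^ (2 * r)).card := by
        exact_mod_cast growth_two_mul_le hsymm hΓ hgen r
      have h3 := hgr (2 * r) (by omega)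
      push_cast at h3
      have hpos : (0 : ℝ) < (Γ ^ (2 * r)).card := by
        exact_mod_cast (Finset.Nonempty.pow hΓ).card_pos
      have h4 : (((Γ ^ (2 * r)).card : ℝ))⁻¹ ≤ c / (r : ℝ) ^ 6 := by
        rw [le_div_iff₀ (by positivity), inv_mul_le_iff₀ hpos]
        have h5 : c * (growth Γ (2 * r) : ℝ) ≤ c * (2 * (Γ ^ (2 * r)).card) := by gcongr
        have h6 : (2 * (r : ℝ)) ^ 6 = 64 * (r : ℝ) ^ 6 := by ring
        have h7 : 0 < (r : ℝ) ^ 6 := by positivity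
        linarith
      linarith)
  -- Times 2k and 2k+1 are both controlled by index `k`, and n + 1 ≤ 2(k + 1) costs a factor 2³.
  refine ⟨8 * M, by positivity, fun n x => ?_⟩
  have heven : ∀ k x, heatKernel ℝ Γ (k + k) x ≤ M / ((k : ℝ) + 1) ^ 3 :=
    fun k x => (heatKernel_even_le hsymm k x).trans (hb k)
  have haux : ∀ k n : ℕ, n ≤ 2 * k + 1 → M / ((k : ℝ) + 1) ^ 3 ≤ 8 * M / ((n : ℝ) + 1) ^ 3 := by
    intro k n hn
    have h1 : (n : ℝ) + 1 ≤ 2 * ((k : ℝ) + 1) := by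
      have : (n : ℝ) ≤ 2 * k + 1 := by exact_mod_cast hn
      linarith
    rw [div_le_div_iff₀ (by positivity) (by positivity)]
    have h2 := pow_le_pow_left₀ (by positivity) h1 3
    nlinarith
  rcases Nat.even_or_odd' n with ⟨k, rfl | rfl⟩
  · refine le_trans ?_ (haux k _ (by omega))
    rw [two_mul]
    exact heven k x
  · refine le_trans ?_ (haux k _ le_rfl)
    rw [two_mul, heatKernel_succ, avgR, inv_mul_le_iff₀ hcard]
    calc ∑ γ ∈ Γ, heatKernel ℝ Γ (k + k) (x * γ) ≤ ∑ γ ∈ Γ, M / ((k : ℝ) + 1) ^ 3 :=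
          Finset.sum_le_sum fun γ _ => heven k _
      _ = _ := by simp

end Decay

/-! ### Green function tails and their quadratic decay. -/

section Green

variable {G : Type*} [Group G] {Γ : Finset G}

lemma heatKernel_ennreal (hΓ : Γ.Nonempty) (n : ℕ) (x : G) :
    heatKernel ℝ≥0∞ Γ n x = ENNReal.ofReal (heatKernel ℝ Γ n x) := by
  classical
  induction n generalizing x with
  | zero =>
    rw [heatKernel_zero, heatKernel_zero, Set.indicator_apply, Set.indicator_apply]
    split_ifs <;> simp
  | succ n ih =>
    have hc : (0 : ℝ) < Γ.card := by exact_mod_cast hΓ.card_pos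
    rw [heatKernel_succ, heatKernel_succ, avgR, avgR, ENNReal.ofReal_mul (by positivity),
      ENNReal.ofReal_inv_of_pos hc, ENNReal.ofReal_natCast,
      ENNReal.ofReal_sum_of_nonneg fun γ _ => heatKernel_nonneg _ _]
    simp_rw [ih]

/-- The expected number of visits to the identity from time `a` on by the walk from `x`. -/
noncomputable def greenTail (Γ : Finset G) (a : ℕ) (x : G) : ℝ≥0∞ :=
  ∑' n, heatKernel ℝ≥0∞ Γ (a + n) x

lemma avgR_greenTail (a : ℕ) : avgR Γ (greenTail Γ a) = greenTail Γ (a + 1) := by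
  ext x
  simp only [greenTail, avgR]
  rw [← Summable.tsum_finsetSum fun γ _ => ENNReal.summable, ← ENNReal.tsum_mul_left]
  refine tsum_congr fun n => ?_
  rw [show a + 1 + n = a + n + 1 by ring, heatKernel_succ, avgR]

lemma avgL_greenTail (a : ℕ) : avgL Γ (greenTail Γ a) = greenTail Γ (a + 1) := by
  ext x
  simp only [greenTail, avgL]
  rw [← Summable.tsum_finsetSum fun γ _ => ENNReal.summable, ← ENNReal.tsum_mul_left]
  refine tsum_congr fun n => ?_
  rw [show a + 1 + n = a + n + 1 by ring, ← avgL_heatKernel, avgL]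

lemma avgR_iterate_greenTail (a b : ℕ) : (avgR Γ)^[b] (greenTail Γ a) = greenTail Γ (a + b) := by
  induction b with
  | zero => rfl
  | succ b ih => rw [Function.iterate_succ_apply', ih, avgR_greenTail, add_assoc]

lemma avgL_iterate_greenTail (a b : ℕ) : (avgL Γ)^[b] (greenTail Γ a) = greenTail Γ (a + b) := by
  induction b with
  | zero => rfl
  | succ b ih => rw [Function.iterate_succ_apply', ih, avgL_greenTail, add_assoc]

lemma greenTail_inv (hsymm : ∀ γ ∈ Γ, γ⁻¹ ∈ Γ) (a : ℕ) (x : G) :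
    greenTail Γ a x⁻¹ = greenTail Γ a x := by
  simp only [greenTail, heatKernel_inv hsymm]

lemma one_le_greenTail_one : 1 ≤ greenTail Γ 0 (1 : G) := by
  classical
  refine le_trans ?_ (ENNReal.le_tsum 0)
  simp [heatKernel_zero]

/-- Telescoping, since 1/t³ ≤ 4/t² - 4/(t+1)² for t ≥ 1. -/
lemma sum_inv_cube_le (a n : ℕ) :
    ∑ k ∈ Finset.range n, 1 / (((a + k : ℕ) : ℝ) + 1) ^ 3 ≤ 4 / ((a : ℝ) + 1) ^ 2 := by
  suffices h : ∑ k ∈ Finset.range n, 1 / (((a + k : ℕ) : ℝ) + 1) ^ 3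
      ≤ 4 / ((a : ℝ) + 1) ^ 2 - 4 / (((a + n : ℕ) : ℝ) + 1) ^ 2 by
    have : 0 ≤ 4 / (((a + n : ℕ) : ℝ) + 1) ^ 2 := by positivity
    linarith
  induction n with
  | zero => simp
  | succ n ih =>
    rw [Finset.sum_range_succ]
    have h : ∀ t : ℝ, 1 ≤ t → 1 / t ^ 3 ≤ 4 / t ^ 2 - 4 / (t + 1) ^ 2 := by
      intro t ht
      have h0 : 0 < t := by linarith
      have e : 4 / t ^ 2 - 4 / (t + 1) ^ 2 - 1 / t ^ 3
          = (4 * t * (t + 1) ^ 2 - 4 * t ^ 3 - (t + 1) ^ 2) / (t ^ 3 * (t + 1) ^ 2) := by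
        field_simp
      have : 0 ≤ (4 * t * (t + 1) ^ 2 - 4 * t ^ 3 - (t + 1) ^ 2) / (t ^ 3 * (t + 1) ^ 2) := by
        apply div_nonneg _ (by positivity)
        nlinarith
      linarith
    have h1 := h (((a + n : ℕ) : ℝ) + 1) (by simp; positivity)
    have e : ((a + (n + 1) : ℕ) : ℝ) + 1 = ((a + n : ℕ) : ℝ) + 1 + 1 := by push_cast; ring
    rw [e]
    linarith

/-- Quadratic decay of the Green function tails, in the form used below. -/
def GreenDecay (Γ : Finset G) (K : ℝ≥0∞) : Prop :=
  ∀ (a : ℕ) (x : G), greenTail Γ a x ≤ K / ((a : ℝ≥0∞) + 1) ^ 2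

lemma exists_greenDecay (hΓ : Γ.Nonempty) {M : ℝ} (hM : 0 < M)
    (h : ∀ n x, heatKernel ℝ Γ n x ≤ M / ((n : ℝ) + 1) ^ 3) :
    ∃ K : ℝ≥0∞, K ≠ ∞ ∧ GreenDecay Γ K := by
  refine ⟨ENNReal.ofReal (4 * M), ENNReal.ofReal_ne_top, fun a x => ?_⟩
  refine ENNReal.tsum_le_of_sum_range_le fun n => ?_
  have e : ENNReal.ofReal (4 * M) / ((a : ℝ≥0∞) + 1) ^ 2
      = ENNReal.ofReal (M * (4 / ((a : ℝ) + 1) ^ 2)) := by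
    rw [show M * (4 / ((a : ℝ) + 1) ^ 2) = 4 * M / ((a : ℝ) + 1) ^ 2 by ring,
      ENNReal.ofReal_div_of_pos (by positivity), ENNReal.ofReal_pow (by positivity),
      ENNReal.ofReal_add (by positivity) (by positivity), ENNReal.ofReal_natCast,
      ENNReal.ofReal_one]
  rw [e]
  simp_rw [heatKernel_ennreal hΓ]
  rw [← ENNReal.ofReal_sum_of_nonneg fun _ _ => heatKernel_nonneg _ _]
  refine ENNReal.ofReal_le_ofReal ?_
  calc ∑ k ∈ Finset.range n, heatKernel ℝ Γ (a + k) x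
      ≤ ∑ k ∈ Finset.range n, M * (1 / (((a + k : ℕ) : ℝ) + 1) ^ 3) :=
        Finset.sum_le_sum fun k _ => (h _ _).trans_eq (by ring)
    _ = M * ∑ k ∈ Finset.range n, 1 / (((a + k : ℕ) : ℝ) + 1) ^ 3 := by rw [Finset.mul_sum]
    _ ≤ _ := by gcongr; exact sum_inv_cube_le a n

end Green

/-! ### Blocks of consecutive steps, their independence and their averages. -/

section Blocks

variable {G Ω : Type*} [Group G]

/-- The product of the `m` steps from time `i` on. -/
def block (X : ℕ → Ω → G) (i m : ℕ) (ω : Ω) : G :=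
  walk (fun k => X (i + k)) 1 m ω

lemma walk_eq_mul (X : ℕ → Ω → G) (g : G) (n : ℕ) (ω : Ω) :
    walk X g n ω = g * walk X 1 n ω := by
  induction n with
  | zero => simp [walk]
  | succ n ih => rw [walk, walk, ih, mul_assoc]

lemma walk_one_eq_block (X : ℕ → Ω → G) (n : ℕ) : walk X 1 n = block X 0 n := by
  ext ω
  simp only [block, zero_add]

lemma block_succ (X : ℕ → Ω → G) (i m : ℕ) (ω : Ω) :
    block X i (m + 1) ω = block X i m ω * X (i + m) ω := rfl

lemma block_zero (X : ℕ → Ω → G) (i : ℕ) (ω : Ω) : block X i 0 ω = 1 := rfl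

lemma block_mul_block (X : ℕ → Ω → G) (i m k : ℕ) (ω : Ω) :
    block X i m ω * block X (i + m) k ω = block X i (m + k) ω := by
  induction k with
  | zero => simp [block_zero]
  | succ k ih => rw [block_succ, ← mul_assoc, ih, ← add_assoc, block_succ, add_assoc]

variable [MeasurableSpace G] [DiscreteMeasurableSpace G]

/-- The events determined by the steps with index in `S`. -/
@[reducible] def stepSigma (X : ℕ → Ω → G) (S : Set ℕ) : MeasurableSpace Ω :=
  ⨆ i ∈ S, MeasurableSpace.comap (X i) inferInstance

variable [Countable G]

lemma measurable_block (X : ℕ → Ω → G) (i m : ℕ) {S : Set ℕ} (hS : Set.Ico i (i + m) ⊆ S) :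
    Measurable[stepSigma X S] (block X i m) := by
  induction m with
  | zero =>
    let _ : MeasurableSpace Ω := stepSigma X S
    exact measurable_const
  | succ m ih =>
    have h1 : Measurable[stepSigma X S] (X (i + m)) := by
      refine Measurable.mono (comap_measurable (X (i + m))) ?_ le_rfl
      exact le_biSup (fun i => MeasurableSpace.comap (X i) inferInstance) (hS ⟨by omega, by omega⟩)
    have h2 := ih (fun k hk => hS ⟨hk.1, by have := hk.2; omega⟩)
    let _ : MeasurableSpace Ω := stepSigma X S
    exact h2.mul h1

variable [MeasurableSpace Ω]

/-- `X` is a sequence of independent uniform elements of `Γ`. -/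
structure IsStepSequence (Γ : Finset G) (P : Measure Ω) (X : ℕ → Ω → G) : Prop where
  meas : ∀ i, Measurable (X i)
  law : ∀ i, P.map (X i) = uniformOn (Γ : Set G)
  indep : iIndepFun X P

variable {Γ : Finset G} {P : Measure Ω} {X : ℕ → Ω → G}

lemma IsStepSequence.stepSigma_le (hX : IsStepSequence Γ P X) (S : Set ℕ) :
    stepSigma X S ≤ ‹MeasurableSpace Ω› :=
  iSup₂_le fun i _ => (hX.meas i).comap_le

lemma IsStepSequence.indep_stepSigma (hX : IsStepSequence Γ P X) {S T : Set ℕ}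
    (h : Disjoint S T) : Indep (stepSigma X S) (stepSigma X T) P :=
  indep_iSup_of_disjoint (fun i => (hX.meas i).comap_le) hX.indep h

lemma IsStepSequence.indepFun {β γ : Type*} [MeasurableSpace β] [MeasurableSpace γ]
    (hX : IsStepSequence Γ P X) {S T : Set ℕ} (h : Disjoint S T) {Y : Ω → β} {Z : Ω → γ}
    (hY : Measurable[stepSigma X S] Y) (hZ : Measurable[stepSigma X T] Z) : IndepFun Y Z P :=
  indep_of_indep_of_le_right (indep_of_indep_of_le_left (hX.indep_stepSigma h) hY.comap_le)
    hZ.comap_le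

lemma IsStepSequence.measurable_block (hX : IsStepSequence Γ P X) (i m : ℕ) :
    Measurable (block X i m) :=
  (RangeCapacity.measurable_block X i m subset_rfl).mono (hX.stepSigma_le _) le_rfl

/-- Fubini for the product law of an independent pair; on countable discrete spaces measurability of
`F` is automatic. -/
lemma lintegral_indep_eq {β γ : Type*} [MeasurableSpace β] [MeasurableSpace γ]
    [DiscreteMeasurableSpace β] [DiscreteMeasurableSpace γ] [Countable β] [Countable γ]
    [IsProbabilityMeasure P] {Y : Ω → β} {Z : Ω → γ} (hY : Measurable Y) (hZ : Measurable Z)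
    (h : IndepFun Y Z P) (F : β → γ → ℝ≥0∞) :
    ∫⁻ ω, F (Y ω) (Z ω) ∂P = ∫⁻ ω, ∫⁻ ω', F (Y ω) (Z ω') ∂P ∂P := by
  have := Measure.isProbabilityMeasure_map (μ := P) hZ.aemeasurable
  have := Measure.isProbabilityMeasure_map (μ := P) hY.aemeasurable
  have hF : Measurable (Function.uncurry F) := Measurable.of_discrete
  have h1 : ∫⁻ ω, F (Y ω) (Z ω) ∂P = ∫⁻ p, Function.uncurry F p ∂(P.map fun ω => (Y ω, Z ω)) :=
    (lintegral_map hF (hY.prodMk hZ)).symm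
  rw [h1, (indepFun_iff_map_prod_eq_prod_map_map hY.aemeasurable hZ.aemeasurable).1 h,
    lintegral_prod _ hF.aemeasurable, lintegral_map Measurable.of_discrete hY]
  refine lintegral_congr fun ω => ?_
  rw [lintegral_map Measurable.of_discrete hZ]
  rfl

lemma IsStepSequence.nonempty [IsProbabilityMeasure P] (hX : IsStepSequence Γ P X) :
    Γ.Nonempty := by
  rw [Finset.nonempty_iff_ne_empty]
  rintro rfl
  have := Measure.isProbabilityMeasure_map (μ := P) (hX.meas 0).aemeasurable
  rw [hX.law 0] at this
  simpa using this.measure_univ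

lemma IsStepSequence.lintegral_step (hX : IsStepSequence Γ P X) (i : ℕ) (f : G → ℝ≥0∞) :
    ∫⁻ ω, f (X i ω) ∂P = (Γ.card : ℝ≥0∞)⁻¹ * ∑ γ ∈ Γ, f γ := by
  rw [← lintegral_map (μ := P) (g := X i) (f := f) Measurable.of_discrete (hX.meas i), hX.law,
    uniformOn, ProbabilityTheory.cond, lintegral_smul_measure, lintegral_finset]
  simp [Measure.count_apply_finset]

lemma IsStepSequence.indepFun_block_step (hX : IsStepSequence Γ P X) (i m : ℕ) :
    IndepFun (block X i m) (X (i + m)) P := by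
  refine hX.indepFun (S := Set.Ico i (i + m)) (T := {i + m}) (by simp)
    (RangeCapacity.measurable_block X i m subset_rfl) ?_
  refine Measurable.mono (comap_measurable (X (i + m))) ?_ le_rfl
  exact le_biSup (fun i => MeasurableSpace.comap (X i) inferInstance) rfl

/-- Integrating out a block on the right is iterated right averaging, so by `avgR_iterate_greenTail`
it moves the start of a Green tail by the block length. -/
lemma IsStepSequence.lintegral_mul_block [IsProbabilityMeasure P] (hX : IsStepSequence Γ P X)
    (i m : ℕ) (f : G → ℝ≥0∞) (x : G) :
    ∫⁻ ω, f (x * block X i m ω) ∂P = (avgR Γ)^[m] f x := by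
  induction m generalizing f with
  | zero => simp [block_zero]
  | succ m ih =>
    rw [Function.iterate_succ_apply, ← ih]
    simp_rw [block_succ, avgR]
    rw [lintegral_indep_eq (hX.measurable_block i m) (hX.meas _) (hX.indepFun_block_step i m)
      fun y z => f (x * (y * z))]
    refine lintegral_congr fun ω => ?_
    rw [hX.lintegral_step (i + m) fun z => f (x * (block X i m ω * z))]
    simp only [mul_assoc]

lemma IsStepSequence.lintegral_block_mul [IsProbabilityMeasure P] (hX : IsStepSequence Γ P X)
    (i m : ℕ) (f : G → ℝ≥0∞) (x : G) :
    ∫⁻ ω, f (block X i m ω * x) ∂P = (avgL Γ)^[m] f x := by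
  induction m generalizing x with
  | zero => simp [block_zero]
  | succ m ih =>
    rw [Function.iterate_succ_apply', avgL]
    simp_rw [← ih, block_succ]
    rw [lintegral_indep_eq (hX.measurable_block i m) (hX.meas _) (hX.indepFun_block_step i m)
      fun y z => f (y * z * x)]
    have hm : ∀ γ, Measurable fun ω => f (block X i m ω * (γ * x)) := fun γ =>
      (Measurable.of_discrete (f := fun y => f (y * (γ * x)))).comp (hX.measurable_block i m)
    rw [← lintegral_finsetSum _ fun γ _ => hm γ,
      ← lintegral_const_mul _ (Finset.measurable_sum _ fun γ _ => hm γ)]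
    refine lintegral_congr fun ω => ?_
    rw [hX.lintegral_step (i + m) fun z => f (block X i m ω * z * x)]
    simp only [mul_assoc]

end Blocks

/-! ### Second moment of the Green function summed across time `n`. -/

section SecondMoment

variable {G Ω : Type*} [Group G] [MeasurableSpace G] [DiscreteMeasurableSpace G] [Countable G]
  [MeasurableSpace Ω] {Γ : Finset G} {P : Measure Ω} {X : ℕ → Ω → G} {K : ℝ≥0∞}

lemma measurable_comp_block (hX : IsStepSequence Γ P X) (f : G → ℝ≥0∞) (i m : ℕ) :
    Measurable fun ω => f (block X i m ω) :=
  Measurable.of_discrete.comp (hX.measurable_block i m)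

lemma lintegral_greenTail_block_le [IsProbabilityMeasure P] (hX : IsStepSequence Γ P X)
    (hK : GreenDecay Γ K) (a i m : ℕ) :
    ∫⁻ ω, greenTail Γ a (block X i m ω) ∂P ≤ K / (((a + m : ℕ) : ℝ≥0∞) + 1) ^ 2 := by
  have h := hX.lintegral_mul_block i m (greenTail Γ a) 1
  simp only [one_mul] at h
  rw [h, avgR_iterate_greenTail]
  exact hK _ _

/-- One interval inside the other: integrating out the `a` steps before and the `b` steps after the
inner block turns the outer Green function into the tail from a + b, which is bounded uniformly. The
inner factor then averages to the tail from `s`. -/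
lemma lintegral_nested_le [IsProbabilityMeasure P] (hX : IsStepSequence Γ P X)
    (hK : GreenDecay Γ K) (t a s b : ℕ) :
    ∫⁻ ω, greenTail Γ 0 (block X (t + a) s ω) * greenTail Γ 0 (block X t (a + s + b) ω) ∂P
      ≤ K / (((a + b : ℕ) : ℝ≥0∞) + 1) ^ 2 * (K / ((s : ℝ≥0∞) + 1) ^ 2) := by
  have hUY : Measurable[stepSigma X (Set.Ico t (t + a + s))]
      fun ω => (block X t a ω, block X (t + a) s ω) :=
    (measurable_block X t a (Set.Ico_subset_Ico le_rfl (by omega))).prodMk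
      (measurable_block X (t + a) s (Set.Ico_subset_Ico (by omega) le_rfl))
  have hI1 : IndepFun (fun ω => (block X t a ω, block X (t + a) s ω)) (block X (t + a + s) b) P :=
    hX.indepFun (T := Set.Ico (t + a + s) (t + a + s + b))
      (Set.Ico_disjoint_Ico_same) hUY (measurable_block X _ _ subset_rfl)
  have hI2 : IndepFun (block X (t + a) s) (block X t a) P :=
    hX.indepFun (Set.Ico_disjoint_Ico_same.symm) (measurable_block X _ _ subset_rfl)
      (measurable_block X t a subset_rfl)
  calc ∫⁻ ω, greenTail Γ 0 (block X (t + a) s ω) * greenTail Γ 0 (block X t (a + s + b) ω) ∂P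
      = ∫⁻ ω, (fun (p : G × G) v => greenTail Γ 0 p.2 * greenTail Γ 0 (p.1 * p.2 * v))
          (block X t a ω, block X (t + a) s ω) (block X (t + a + s) b ω) ∂P := by
        refine lintegral_congr fun ω => ?_
        simp only
        rw [block_mul_block, add_assoc t a s, block_mul_block]
    _ = ∫⁻ ω, greenTail Γ 0 (block X (t + a) s ω)
          * greenTail Γ b (block X t a ω * block X (t + a) s ω) ∂P := by
        refine (lintegral_indep_eq (hUY.mono (hX.stepSigma_le _) le_rfl)
          (hX.measurable_block _ _) hI1 fun (p : G × G) v => greenTail Γ 0 p.2 * greenTail Γ 0 (p.1 * p.2 * v)).trans ?_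
        refine lintegral_congr fun ω => ?_
        simp only
        refine (lintegral_const_mul _ (measurable_comp_block hX
          (fun v => greenTail Γ 0 (block X t a ω * block X (t + a) s ω * v)) _ _)).trans ?_
        rw [hX.lintegral_mul_block, avgR_iterate_greenTail, zero_add]
    _ = ∫⁻ ω, greenTail Γ 0 (block X (t + a) s ω)
          * greenTail Γ (a + b) (block X (t + a) s ω) ∂P := by
        rw [lintegral_indep_eq (hX.measurable_block _ _) (hX.measurable_block _ _) hI2
          fun y u => greenTail Γ 0 y * greenTail Γ b (u * y)]
        refine lintegral_congr fun ω => ?_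
        refine (lintegral_const_mul _ (measurable_comp_block hX
          (fun u => greenTail Γ b (u * block X (t + a) s ω)) _ _)).trans ?_
        rw [hX.lintegral_block_mul, avgL_iterate_greenTail, add_comm b a]
    _ ≤ ∫⁻ ω, K / (((a + b : ℕ) : ℝ≥0∞) + 1) ^ 2 * greenTail Γ 0 (block X (t + a) s ω) ∂P := by
        refine lintegral_mono fun ω => ?_
        rw [mul_comm]
        exact mul_le_mul_left (hK _ _) _
    _ ≤ _ := by
        rw [lintegral_const_mul _ (measurable_comp_block hX _ _ _)]
        refine mul_le_mul_right ?_ _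
        simpa using lintegral_greenTail_block_le hX hK 0 (t + a) s

/-- Intervals overlapping in `s` steps: the unshared steps leave a product of tails from `a` and `b`
at the common block. The tail with the larger index is bounded uniformly, at the price of 4 because
the maximum is at least (a + b)/2, and the other is averaged over the block. -/
lemma lintegral_overlap_le [IsProbabilityMeasure P] (hX : IsStepSequence Γ P X)
    (hK : GreenDecay Γ K) (t a s b : ℕ) :
    ∫⁻ ω, greenTail Γ 0 (block X (t + a) (s + b) ω) * greenTail Γ 0 (block X t (a + s) ω) ∂P
      ≤ 4 * (K / (((a + b : ℕ) : ℝ≥0∞) + 1) ^ 2 * (K / ((s : ℝ≥0∞) + 1) ^ 2)) := by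
  have hUY : Measurable[stepSigma X (Set.Ico t (t + a + s))]
      fun ω => (block X t a ω, block X (t + a) s ω) :=
    (measurable_block X t a (Set.Ico_subset_Ico le_rfl (by omega))).prodMk
      (measurable_block X (t + a) s (Set.Ico_subset_Ico (by omega) le_rfl))
  have hI1 : IndepFun (fun ω => (block X t a ω, block X (t + a) s ω)) (block X (t + a + s) b) P :=
    hX.indepFun (T := Set.Ico (t + a + s) (t + a + s + b))
      (Set.Ico_disjoint_Ico_same) hUY (measurable_block X _ _ subset_rfl)
  have hI2 : IndepFun (block X (t + a) s) (block X t a) P :=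
    hX.indepFun (Set.Ico_disjoint_Ico_same.symm) (measurable_block X _ _ subset_rfl)
      (measurable_block X t a subset_rfl)
  have hmax : ∀ x : G, greenTail Γ b x * greenTail Γ a x
      ≤ 4 * (K / (((a + b : ℕ) : ℝ≥0∞) + 1) ^ 2) * (greenTail Γ (min a b) x) := by
    have hq : ∀ c : ℕ, a + b ≤ 2 * c → K / ((c : ℝ≥0∞) + 1) ^ 2
        ≤ 4 * (K / (((a + b : ℕ) : ℝ≥0∞) + 1) ^ 2) := by
      intro c hc
      rw [div_eq_mul_inv, div_eq_mul_inv, mul_left_comm]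
      refine mul_le_mul_right ?_ _
      have h4 : (4 : ℝ≥0∞) = (4⁻¹)⁻¹ := by simp
      rw [h4, ← ENNReal.mul_inv (by simp) (by simp), ENNReal.inv_le_inv,
        ENNReal.inv_mul_le_iff (by simp) (by simp)]
      have : (((a + b : ℕ) + 1) ^ 2 : ℕ) ≤ 4 * (c + 1) ^ 2 := by nlinarith
      exact_mod_cast this
    intro x
    rcases le_total a b with h | h
    · rw [min_eq_left h]
      exact mul_le_mul_left ((hK b x).trans (hq b (by omega))) _
    · rw [min_eq_right h, mul_comm]
      exact mul_le_mul_left ((hK a x).trans (hq a (by omega))) _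
  calc ∫⁻ ω, greenTail Γ 0 (block X (t + a) (s + b) ω) * greenTail Γ 0 (block X t (a + s) ω) ∂P
      = ∫⁻ ω, (fun (p : G × G) v => greenTail Γ 0 (p.1 * p.2) * greenTail Γ 0 (p.2 * v))
          (block X t a ω, block X (t + a) s ω) (block X (t + a + s) b ω) ∂P := by
        refine lintegral_congr fun ω => ?_
        simp only
        rw [block_mul_block, block_mul_block, mul_comm]
    _ = ∫⁻ ω, greenTail Γ b (block X (t + a) s ω)
          * greenTail Γ 0 (block X t a ω * block X (t + a) s ω) ∂P := by
        refine (lintegral_indep_eq (hUY.mono (hX.stepSigma_le _) le_rfl)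
          (hX.measurable_block _ _) hI1 fun (p : G × G) v => greenTail Γ 0 (p.1 * p.2) * greenTail Γ 0 (p.2 * v)).trans ?_
        refine lintegral_congr fun ω => ?_
        simp only
        refine (lintegral_const_mul _ (measurable_comp_block hX
          (fun v => greenTail Γ 0 (block X (t + a) s ω * v)) _ _)).trans ?_
        rw [hX.lintegral_mul_block, avgR_iterate_greenTail, zero_add, mul_comm]
    _ = ∫⁻ ω, greenTail Γ b (block X (t + a) s ω)
          * greenTail Γ a (block X (t + a) s ω) ∂P := by
        rw [lintegral_indep_eq (hX.measurable_block _ _) (hX.measurable_block _ _) hI2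
          fun y u => greenTail Γ b y * greenTail Γ 0 (u * y)]
        refine lintegral_congr fun ω => ?_
        refine (lintegral_const_mul _ (measurable_comp_block hX
          (fun u => greenTail Γ 0 (u * block X (t + a) s ω)) _ _)).trans ?_
        rw [hX.lintegral_block_mul, avgL_iterate_greenTail, zero_add]
    _ ≤ ∫⁻ ω, 4 * (K / (((a + b : ℕ) : ℝ≥0∞) + 1) ^ 2)
          * greenTail Γ (min a b) (block X (t + a) s ω) ∂P := lintegral_mono fun ω => hmax _
    _ ≤ _ := by
        rw [lintegral_const_mul _ (measurable_comp_block hX _ _ _), mul_assoc]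
        refine mul_le_mul_right (mul_le_mul_right ?_ _) _
        refine (lintegral_greenTail_block_le hX hK (min a b) (t + a) s).trans ?_
        refine ENNReal.div_le_div_left ?_ _
        gcongr
        omega

/-- The weight of a pair of times in the second moment estimate. -/
noncomputable def pairWeight (i k : ℕ) : ℝ≥0∞ :=
  ((min i k : ℕ) + 1 : ℝ≥0∞)⁻¹ * ((max i k - min i k : ℕ) + 1 : ℝ≥0∞)⁻¹

lemma pairWeight_comm (i k : ℕ) : pairWeight i k = pairWeight k i := by
  rw [pairWeight, pairWeight, min_comm, max_comm]

lemma div_add_one_sq_le (a b : ℕ) : K / (((a + b : ℕ) : ℝ≥0∞) + 1) ^ 2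
    ≤ K * (((a : ℝ≥0∞) + 1)⁻¹ * ((b : ℝ≥0∞) + 1)⁻¹) := by
  rw [div_eq_mul_inv, ← ENNReal.mul_inv (by simp) (by simp)]
  refine mul_le_mul_right ?_ _
  rw [ENNReal.inv_le_inv]
  have : (a + 1) * (b + 1) ≤ (a + b + 1) ^ 2 := by nlinarith
  exact_mod_cast this

/-- Both intervals contain time `n`, so they are nested or overlapping, with unshared lengths k - i
and |j - l| and common length i + min j l. Splitting each inverse square into two inverse first
powers separates past indices from future ones. -/
lemma lintegral_pair_le_of_le [IsProbabilityMeasure P] (hX : IsStepSequence Γ P X)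
    (hK : GreenDecay Γ K) {n i k : ℕ} (hk : k ≤ n) (hik : i ≤ k) (j l : ℕ) :
    ∫⁻ ω, greenTail Γ 0 (block X (n - i) (i + j) ω) * greenTail Γ 0 (block X (n - k) (k + l) ω) ∂P
      ≤ 4 * K ^ 2 * (pairWeight i k * pairWeight j l) := by
  have key : ∀ s b : ℕ, s = i + min j l → b = max j l - min j l →
      4 * (K / (((k - i + b : ℕ) : ℝ≥0∞) + 1) ^ 2 * (K / ((s : ℝ≥0∞) + 1) ^ 2))
        ≤ 4 * K ^ 2 * (pairWeight i k * pairWeight j l) := by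
    rintro s b rfl rfl
    calc _ ≤ 4 * (K * ((((k - i : ℕ) : ℝ≥0∞) + 1)⁻¹ * (((max j l - min j l : ℕ) : ℝ≥0∞) + 1)⁻¹)
          * (K * (((i : ℝ≥0∞) + 1)⁻¹ * (((min j l : ℕ) : ℝ≥0∞) + 1)⁻¹))) := by
          gcongr
          · exact div_add_one_sq_le _ _
          · exact div_add_one_sq_le _ _
      _ = _ := by
          rw [pairWeight, pairWeight, min_eq_left hik, max_eq_right hik]
          ring
  rcases le_total j l with hjl | hjl
  · have h := lintegral_nested_le hX hK (n - k) (k - i) (i + j) (l - j)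
    rw [show n - k + (k - i) = n - i by omega, show k - i + (i + j) + (l - j) = k + l by omega] at h
    refine h.trans (le_trans ?_ (key (i + j) (l - j) (by rw [min_eq_left hjl])
      (by rw [min_eq_left hjl, max_eq_right hjl])))
    exact le_mul_of_one_le_left' (by norm_num)
  · have h := lintegral_overlap_le hX hK (n - k) (k - i) (i + l) (j - l)
    rw [show n - k + (k - i) = n - i by omega, show k - i + (i + l) = k + l by omega,
      show i + l + (j - l) = i + j by omega] at h
    exact h.trans (key (i + l) (j - l) (by rw [min_eq_right hjl])
      (by rw [min_eq_right hjl, max_eq_left hjl]))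

lemma lintegral_pair_le [IsProbabilityMeasure P] (hX : IsStepSequence Γ P X)
    (hK : GreenDecay Γ K) {n i k : ℕ} (hi : i ≤ n) (hk : k ≤ n) (j l : ℕ) :
    ∫⁻ ω, greenTail Γ 0 (block X (n - i) (i + j) ω) * greenTail Γ 0 (block X (n - k) (k + l) ω) ∂P
      ≤ 4 * K ^ 2 * (pairWeight i k * pairWeight j l) := by
  rcases le_total i k with h | h
  · exact lintegral_pair_le_of_le hX hK hk h j l
  · rw [pairWeight_comm i, pairWeight_comm j]
    simp_rw [mul_comm (greenTail Γ 0 (block X (n - i) (i + j) _))]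
    exact lintegral_pair_le_of_le hX hK hi h l j

/-- The sum of the Green function over pairs of times up to `n` before and up to `m` after
time `n`. -/
noncomputable def greenSum (Γ : Finset G) (X : ℕ → Ω → G) (n m : ℕ) (ω : Ω) : ℝ≥0∞ :=
  ∑ i ∈ Finset.range (n + 1), ∑ j ∈ Finset.range (m + 1), greenTail Γ 0 (block X (n - i) (i + j) ω)

lemma measurable_greenSum (hX : IsStepSequence Γ P X) (n m : ℕ) :
    Measurable (greenSum Γ X n m) :=
  Finset.measurable_sum _ fun _ _ => Finset.measurable_sum _ fun _ _ =>
    measurable_comp_block hX _ _ _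

lemma lintegral_greenSum_sq_le [IsProbabilityMeasure P] (hX : IsStepSequence Γ P X)
    (hK : GreenDecay Γ K) (n m : ℕ) :
    ∫⁻ ω, greenSum Γ X n m ω ^ 2 ∂P ≤ 4 * K ^ 2 *
      ((∑ i ∈ Finset.range (n + 1), ∑ k ∈ Finset.range (n + 1), pairWeight i k) *
        ∑ j ∈ Finset.range (m + 1), ∑ l ∈ Finset.range (m + 1), pairWeight j l) := by
  set S := Finset.range (n + 1) ×ˢ Finset.range (m + 1)
  set f : ℕ × ℕ → Ω → ℝ≥0∞ := fun p ω => greenTail Γ 0 (block X (n - p.1) (p.1 + p.2) ω)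
  have hf : ∀ p, Measurable (f p) := fun p => measurable_comp_block hX _ _ _
  have e : ∀ ω, greenSum Γ X n m ω ^ 2 = ∑ p ∈ S, ∑ q ∈ S, f p ω * f q ω := by
    intro ω
    rw [greenSum, ← Finset.sum_product', pow_two, Finset.sum_mul_sum]
  simp_rw [e]
  have e2 : ∫⁻ ω, ∑ p ∈ S, ∑ q ∈ S, f p ω * f q ω ∂P = ∑ p ∈ S, ∑ q ∈ S, ∫⁻ ω, f p ω * f q ω ∂P := by
    refine (lintegral_finsetSum _ fun p _ =>
      Finset.measurable_sum _ fun q _ => (hf p).mul (hf q)).trans ?_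
    exact Finset.sum_congr rfl fun p _ => lintegral_finsetSum _ fun q _ => (hf p).mul (hf q)
  rw [e2]
  calc ∑ p ∈ S, ∑ q ∈ S, ∫⁻ ω, f p ω * f q ω ∂P
      ≤ ∑ p ∈ S, ∑ q ∈ S, 4 * K ^ 2 * (pairWeight p.1 q.1 * pairWeight p.2 q.2) := by
        refine Finset.sum_le_sum fun p hp => Finset.sum_le_sum fun q hq => ?_
        simp only [S, Finset.mem_product, Finset.mem_range] at hp hq
        exact lintegral_pair_le hX hK (by omega) (by omega) _ _
    _ = _ := by
        simp_rw [← Finset.mul_sum]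
        congr 1
        simp_rw [S, Finset.sum_product, Finset.sum_mul_sum]

end SecondMoment

/-! ### Summation of the weights, with logarithms replaced by small powers. -/

section Weights

/-- After symmetrizing, the substitution k ↦ k - i decouples the double sum into a product of two
harmonic sums. -/
lemma sum_pairWeight_le (N : ℕ) :
    ∑ i ∈ Finset.range N, ∑ k ∈ Finset.range N, pairWeight i k
      ≤ 2 * (∑ i ∈ Finset.range N, ((i : ℝ≥0∞) + 1)⁻¹) ^ 2 := by
  set v : ℕ → ℕ → ℝ≥0∞ := fun i k =>
    if i ≤ k then ((i : ℝ≥0∞) + 1)⁻¹ * (((k - i : ℕ) : ℝ≥0∞) + 1)⁻¹ else 0 with hv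
  have h1 : ∀ i k, pairWeight i k ≤ v i k + v k i := by
    intro i k
    rcases le_total i k with h | h
    · rw [pairWeight, min_eq_left h, max_eq_right h, hv]
      simp [h]
    · rw [pairWeight, min_eq_right h, max_eq_left h, hv]
      simp [h]
  have h2 : ∑ i ∈ Finset.range N, ∑ k ∈ Finset.range N, v i k
      ≤ (∑ i ∈ Finset.range N, ((i : ℝ≥0∞) + 1)⁻¹) ^ 2 := by
    rw [pow_two, Finset.sum_mul]
    refine Finset.sum_le_sum fun i _ => ?_
    rw [hv]
    simp only
    rw [← Finset.sum_filter, ← Finset.mul_sum]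
    refine mul_le_mul_right ?_ _
    rw [← Finset.sum_image (f := fun k : ℕ => ((k : ℝ≥0∞) + 1)⁻¹) (g := fun k => k - i)]
    · refine Finset.sum_le_sum_of_subset fun k hk => ?_
      simp only [Finset.mem_image, Finset.mem_filter, Finset.mem_range] at hk ⊢
      omega
    · intro x hx y hy h
      have hx' := (Finset.mem_filter.1 hx).2
      have hy' := (Finset.mem_filter.1 hy).2
      simp only at h
      omega
  calc _ ≤ ∑ i ∈ Finset.range N, ∑ k ∈ Finset.range N, (v i k + v k i) :=
        Finset.sum_le_sum fun i _ => Finset.sum_le_sum fun k _ => h1 i k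
    _ = ∑ i ∈ Finset.range N, ∑ k ∈ Finset.range N, v i k
        + ∑ i ∈ Finset.range N, ∑ k ∈ Finset.range N, v i k := by
        simp_rw [Finset.sum_add_distrib]
        congr 1
        exact Finset.sum_comm
    _ ≤ _ := by rw [two_mul]; gcongr

lemma sum_inv_le_rpow {N : ℕ} (hN : 1 ≤ N) :
    ∑ i ∈ Finset.range N, ((i : ℝ≥0∞) + 1)⁻¹ ≤ ENNReal.ofReal (9 * (N : ℝ) ^ (1 / 8 : ℝ)) := by
  have h1 : ∑ i ∈ Finset.range N, ((i : ℝ≥0∞) + 1)⁻¹ = ENNReal.ofReal (harmonic N : ℝ) := by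
    rw [harmonic]
    push_cast
    rw [ENNReal.ofReal_sum_of_nonneg fun i _ => by positivity]
    refine Finset.sum_congr rfl fun i _ => ?_
    rw [ENNReal.ofReal_inv_of_pos (by positivity), ENNReal.ofReal_add (by positivity) (by positivity)]
    simp
  rw [h1]
  refine ENNReal.ofReal_le_ofReal ((harmonic_le_one_add_log N).trans ?_)
  have h2 := Real.log_le_rpow_div (x := (N : ℝ)) (by positivity) (ε := 1 / 8) (by norm_num)
  have h3 : 1 ≤ (N : ℝ) ^ (1 / 8 : ℝ) :=
    Real.one_le_rpow (by exact_mod_cast hN) (by norm_num)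
  linarith

end Weights

section SecondMomentBound

variable {G Ω : Type*} [Group G] [MeasurableSpace G] [DiscreteMeasurableSpace G] [Countable G]
  [MeasurableSpace Ω] {Γ : Finset G} {P : Measure Ω} {X : ℕ → Ω → G} {K : ℝ≥0∞}

lemma exists_lintegral_greenSum_sq_le [IsProbabilityMeasure P] (hX : IsStepSequence Γ P X)
    (hK : GreenDecay Γ K) (hKtop : K ≠ ∞) :
    ∃ C : ℝ, 0 ≤ C ∧ ∀ n m : ℕ, 1 ≤ n → 1 ≤ m →
      ∫⁻ ω, greenSum Γ X n m ω ^ 2 ∂P ≤ ENNReal.ofReal (C * ((n + m : ℕ) : ℝ) ^ (1 / 2 : ℝ)) := by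
  refine ⟨(4 * K.toReal ^ 2) * (2 * 9 ^ 2) ^ 2, by positivity, fun n m hn hm => ?_⟩
  set R : ℝ := ((n + m : ℕ) : ℝ) ^ (1 / 8 : ℝ) with hR
  -- Four harmonic sums occur in total, so the exponent 1/8 yields 1/2. Positivity of `n` and `m`
  -- gives n + 1, m + 1 ≤ n + m.
  have hb : ∀ k : ℕ, k + 1 ≤ n + m →
      ∑ i ∈ Finset.range (k + 1), ∑ l ∈ Finset.range (k + 1), pairWeight i l
        ≤ ENNReal.ofReal (2 * (9 * R) ^ 2) := by
    intro k hk
    refine (sum_pairWeight_le _).trans ?_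
    rw [ENNReal.ofReal_mul (by norm_num), ENNReal.ofReal_pow (by positivity)]
    have h1 := sum_inv_le_rpow (N := k + 1) (by omega)
    have h2 : ENNReal.ofReal (9 * ((k + 1 : ℕ) : ℝ) ^ (1 / 8 : ℝ)) ≤ ENNReal.ofReal (9 * R) := by
      refine ENNReal.ofReal_le_ofReal ?_
      rw [hR]
      gcongr
    have h3 : ENNReal.ofReal 2 = 2 := by simp
    rw [h3]
    gcongr
    exact h1.trans h2
  have hR4 : R ^ 4 = ((n + m : ℕ) : ℝ) ^ (1 / 2 : ℝ) := by
    rw [hR, ← Real.rpow_natCast, ← Real.rpow_mul (by positivity)]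
    norm_num
  calc _ ≤ _ := lintegral_greenSum_sq_le hX hK n m
    _ ≤ ENNReal.ofReal (4 * K.toReal ^ 2) *
        (ENNReal.ofReal (2 * (9 * R) ^ 2) * ENNReal.ofReal (2 * (9 * R) ^ 2)) := by
        have : ENNReal.ofReal (4 * K.toReal ^ 2) = 4 * K ^ 2 := by
          rw [ENNReal.ofReal_mul (by norm_num), ENNReal.ofReal_pow (by positivity),
            ENNReal.ofReal_toReal hKtop]
          simp
        rw [this]
        gcongr
        · exact hb n (by omega)
        · exact hb m (by omega)
    _ = _ := by
        rw [← ENNReal.ofReal_mul (by positivity), ← ENNReal.ofReal_mul (by positivity), ← hR4]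
        congr 1
        ring

end SecondMomentBound

/-! ### Capacity: subadditivity, left invariance and the error of additivity. -/

section Capacity

variable {G Ω : Type*} [Group G]

lemma returnTime_eq_top_iff (X : ℕ → Ω → G) (g : G) (A : Set G) (ω : Ω) :
    returnTime X g A ω = ⊤ ↔ ∀ n : ℕ, 1 ≤ n → walk X g n ω ∉ A := by
  simp only [returnTime, iInf_eq_top, ENat.natCast_ne_top, imp_false, not_and]

variable [MeasurableSpace Ω] {P : Measure Ω} {X : ℕ → Ω → G}

/-- The probability that the walk from `g` never returns to `A`. -/
noncomputable def escape (P : Measure Ω) (X : ℕ → Ω → G) (A : Set G) (g : G) : ℝ≥0∞ :=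
  P {ω | returnTime X g A ω = ⊤}

lemma cap_eq_tsum_escape (A : Set G) : cap P X A = ∑' g : A, escape P X A g := rfl

lemma escape_anti {A B : Set G} (h : A ⊆ B) (g : G) : escape P X B g ≤ escape P X A g := by
  refine measure_mono fun ω hω => ?_
  simp only [Set.mem_ofPred_eq, returnTime_eq_top_iff] at hω ⊢
  exact fun n hn hA => hω n hn (h hA)

lemma escape_le_one [IsProbabilityMeasure P] (A : Set G) (g : G) : escape P X A g ≤ 1 := prob_le_one

lemma cap_union_le (A B : Set G) : cap P X (A ∪ B) ≤ cap P X A + cap P X B := by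
  simp only [cap_eq_tsum_escape]
  refine (ENNReal.tsum_union_le (escape P X (A ∪ B)) A B).trans (add_le_add ?_ ?_)
  · exact ENNReal.tsum_le_tsum fun g => escape_anti Set.subset_union_left _
  · exact ENNReal.tsum_le_tsum fun g => escape_anti Set.subset_union_right _

lemma walk_mul_left (X : ℕ → Ω → G) (g x : G) (n : ℕ) (ω : Ω) :
    walk X (g * x) n ω = g * walk X x n ω := by
  rw [walk_eq_mul, walk_eq_mul X x, mul_assoc]

lemma cap_image_mul_left (g : G) (A : Set G) : cap P X ((g * ·) '' A) = cap P X A := by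
  simp only [cap_eq_tsum_escape]
  rw [tsum_image (escape P X ((g * ·) '' A)) (mul_right_injective g).injOn]
  refine tsum_congr fun x => ?_
  simp only [escape, returnTime_eq_top_iff, walk_mul_left]
  congr 1
  ext ω
  simp

lemma tsum_add_tsum_eq (f : G → ℝ≥0∞) (A B : Set G) :
    ∑' x : A, f x + ∑' x : B, f x
      = ∑' x : (A ∪ B : Set G), f x + ∑' x : (A ∩ B : Set G), f x := by
  simp only [tsum_subtype]
  rw [← ENNReal.tsum_add, ← ENNReal.tsum_add]
  refine tsum_congr fun x => ?_
  exact (congrFun (Set.indicator_union_add_inter f A B) x).symm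

variable [MeasurableSpace G] [DiscreteMeasurableSpace G] [Countable G] {Γ : Finset G}

lemma IsStepSequence.measure_walk_eq [IsProbabilityMeasure P] (hX : IsStepSequence Γ P X)
    (x b : G) (n : ℕ) : P {ω | walk X x n ω = b} = heatKernel ℝ≥0∞ Γ n (b⁻¹ * x) := by
  classical
  rw [heatKernel, ← hX.lintegral_mul_block 0 n, ← walk_one_eq_block]
  have hm : Measurable (walk X 1 n) := by
    rw [walk_one_eq_block]
    exact hX.measurable_block 0 n
  have hset : MeasurableSet {ω | walk X x n ω = b} := by
    simp_rw [walk_eq_mul X x]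
    exact hm ((Set.to_countable {w : G | x * w = b}).measurableSet)
  rw [← lintegral_indicator_one hset]
  refine lintegral_congr fun ω => ?_
  rw [Set.indicator_apply, Set.indicator_apply]
  simp only [Set.mem_ofPred_eq, Set.mem_singleton_iff, walk_eq_mul X x, Pi.one_apply]
  congr 1
  rw [mul_assoc, inv_mul_eq_one]
  exact propext eq_comm

/-- A walk that avoids `A` but not A ∪ B visits `B`; a union bound over the points of `B` and over
all times gives Green functions. Including time 0 only enlarges the bound. -/
lemma escape_le_add [IsProbabilityMeasure P] (hX : IsStepSequence Γ P X) (A B : Set G) (x : G) :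
    escape P X A x ≤ escape P X (A ∪ B) x + ∑' b : B, greenTail Γ 0 ((b : G)⁻¹ * x) := by
  have hsub : {ω | returnTime X x A ω = ⊤} ⊆ {ω | returnTime X x (A ∪ B) ω = ⊤} ∪
      ⋃ (b : B) (n : ℕ), {ω | walk X x n ω = b} := by
    intro ω hω
    by_cases h : ω ∈ ⋃ (b : B) (n : ℕ), {ω | walk X x n ω = b}
    · exact Or.inr h
    · left
      simp only [Set.mem_ofPred_eq, returnTime_eq_top_iff] at hω ⊢
      rintro n hn (hA | hB)
      · exact hω n hn hA
      · exact h (Set.mem_iUnion₂.2 ⟨⟨_, hB⟩, n, rfl⟩)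
  refine (measure_mono hsub).trans ((measure_union_le _ _).trans (add_le_add le_rfl ?_))
  refine (measure_iUnion_le _).trans (ENNReal.tsum_le_tsum fun b => ?_)
  refine (measure_iUnion_le _).trans (ENNReal.tsum_le_tsum fun n => ?_)
  rw [hX.measure_walk_eq, zero_add]

/-- Two of the three copies of `Q` pay for the change of escape probability on `A` and on `B`; the
third pays for A ∩ B being counted twice. -/
lemma cap_add_cap_le [IsProbabilityMeasure P] (hX : IsStepSequence Γ P X)
    (hsymm : ∀ γ ∈ Γ, γ⁻¹ ∈ Γ) (A B : Set G) :
    cap P X A + cap P X B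
      ≤ cap P X (A ∪ B) + 3 * ∑' a : A, ∑' b : B, greenTail Γ 0 ((a : G)⁻¹ * b) := by
  set Q := ∑' a : A, ∑' b : B, greenTail Γ 0 ((a : G)⁻¹ * b) with hQ
  set f := escape P X (A ∪ B)
  have hinv : ∀ a b : G, greenTail Γ 0 (b⁻¹ * a) = greenTail Γ 0 (a⁻¹ * b) := by
    intro a b
    rw [← greenTail_inv hsymm]
    simp
  have hA : cap P X A ≤ ∑' a : A, f a + Q := by
    rw [cap_eq_tsum_escape, hQ, ← ENNReal.tsum_add]
    refine ENNReal.tsum_le_tsum fun a => (escape_le_add hX A B a).trans_eq ?_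
    simp_rw [hinv]
    rfl
  have hB : cap P X B ≤ ∑' b : B, f b + Q := by
    rw [cap_eq_tsum_escape, hQ, ENNReal.tsum_comm, ← ENNReal.tsum_add]
    refine ENNReal.tsum_le_tsum fun b => (escape_le_add hX B A b).trans_eq ?_
    rw [Set.union_comm]
  -- Each common point is paid for by its diagonal term, as the Green function is at least 1 at the
  -- identity.
  have hI : ∑' x : (A ∩ B : Set G), f x ≤ Q := by
    calc ∑' x : (A ∩ B : Set G), f x
        ≤ ∑' x : (A ∩ B : Set G), ∑' b : B, greenTail Γ 0 ((x : G)⁻¹ * b) := by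
          refine ENNReal.tsum_le_tsum fun x => (escape_le_one _ _).trans ?_
          refine le_trans ?_ (ENNReal.le_tsum ⟨x, x.2.2⟩)
          simpa using one_le_greenTail_one
      _ ≤ Q := ENNReal.tsum_mono_subtype (fun x => ∑' b : B, greenTail Γ 0 (x⁻¹ * (b : G)))
          Set.inter_subset_left
  calc cap P X A + cap P X B ≤ (∑' a : A, f a + Q) + (∑' b : B, f b + Q) := add_le_add hA hB
    _ = (∑' a : A, f a + ∑' b : B, f b) + 2 * Q := by ring
    _ = cap P X (A ∪ B) + ∑' x : (A ∩ B : Set G), f x + 2 * Q := by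
        rw [tsum_add_tsum_eq]; rfl
    _ ≤ cap P X (A ∪ B) + Q + 2 * Q := by gcongr
    _ = _ := by ring

end Capacity

/-! ### The range of the walk, split at time `n`. -/

section Range

variable {G Ω : Type*} [Group G]

lemma walkRange_eq_range (Y : ℕ → Ω → G) (n : ℕ) (ω : Ω) :
    walkRange Y n ω = Set.range fun k : Fin (n + 1) => walk Y 1 k ω := by
  ext g
  simp only [walkRange, Set.mem_ofPred_eq, Set.mem_range]
  constructor
  · rintro ⟨k, hk, rfl⟩
    exact ⟨⟨k, by omega⟩, rfl⟩
  · rintro ⟨k, rfl⟩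
    exact ⟨k, by omega, rfl⟩

lemma walkRange_eq_biUnion (Y : ℕ → Ω → G) (n : ℕ) (ω : Ω) :
    walkRange Y n ω = ⋃ k ∈ Finset.range (n + 1), {walk Y 1 k ω} := by
  ext g
  simp [walkRange, eq_comm]

lemma tsum_walkRange_le (Y : ℕ → Ω → G) (n : ℕ) (ω : Ω) (f : G → ℝ≥0∞) :
    ∑' x : walkRange Y n ω, f x ≤ ∑ k ∈ Finset.range (n + 1), f (walk Y 1 k ω) := by
  rw [walkRange_eq_biUnion]
  refine (ENNReal.tsum_biUnion_le f _ _).trans (Finset.sum_le_sum fun k _ => ?_)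
  simp

/-- The range splits at time `n` into the past and a translate of the range of the shifted walk. -/
lemma walkRange_add (X : ℕ → Ω → G) (n m : ℕ) (ω : Ω) :
    walkRange X (n + m) ω
      = walkRange X n ω ∪ (walk X 1 n ω * ·) '' walkRange (fun k => X (n + k)) m ω := by
  have h : ∀ j, walk X 1 n ω * walk (fun k => X (n + k)) 1 j ω = walk X 1 (n + j) ω := by
    intro j
    rw [walk_one_eq_block X, walk_one_eq_block X, ← block_mul_block, zero_add]
    rfl
  ext g
  simp only [walkRange, Set.mem_ofPred_eq, Set.mem_union, Set.mem_image, exists_exists_and_eq_and, h]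
  constructor
  · rintro ⟨k, hk, rfl⟩
    rcases le_total k n with hkn | hkn
    · exact Or.inl ⟨k, hkn, rfl⟩
    · exact Or.inr ⟨k - n, by omega, by rw [show n + (k - n) = k by omega]⟩
  · rintro (⟨k, hk, rfl⟩ | ⟨k, hk, rfl⟩)
    · exact ⟨k, by omega, rfl⟩
    · exact ⟨n + k, by omega, rfl⟩

variable [MeasurableSpace Ω] {P : Measure Ω} {X : ℕ → Ω → G}

lemma cap_walkRange_le [IsProbabilityMeasure P] {Ω' : Type*} (Y : ℕ → Ω' → G) (n : ℕ) (ω : Ω') :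
    cap P X (walkRange Y n ω) ≤ (n + 1 : ℕ) := by
  rw [cap_eq_tsum_escape]
  refine (tsum_walkRange_le Y n ω _).trans ?_
  calc _ ≤ ∑ k ∈ Finset.range (n + 1), (1 : ℝ≥0∞) :=
        Finset.sum_le_sum fun k _ => escape_le_one _ _
    _ = _ := by simp

variable [MeasurableSpace G] [DiscreteMeasurableSpace G] [Countable G] {Γ : Finset G}

lemma cap_walkRange_add_le (n m : ℕ) (ω : Ω) :
    cap P X (walkRange X (n + m) ω)
      ≤ cap P X (walkRange X n ω) + cap P X (walkRange (fun k => X (n + k)) m ω) := by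
  rw [walkRange_add]
  exact (cap_union_le _ _).trans_eq (by rw [cap_image_mul_left])

lemma le_cap_walkRange_add [IsProbabilityMeasure P] (hX : IsStepSequence Γ P X)
    (hsymm : ∀ γ ∈ Γ, γ⁻¹ ∈ Γ) (n m : ℕ) (ω : Ω) :
    cap P X (walkRange X n ω) + cap P X (walkRange (fun k => X (n + k)) m ω)
      ≤ cap P X (walkRange X (n + m) ω) + 3 * greenSum Γ X n m ω := by
  rw [walkRange_add, ← cap_image_mul_left (walk X 1 n ω) (walkRange (fun k => X (n + k)) m ω)]
  refine (cap_add_cap_le hX hsymm _ _).trans ?_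
  gcongr
  set S := walk X 1 n ω
  refine (tsum_walkRange_le X n ω fun a => ∑' b : ((S * ·) ''
    walkRange (fun k => X (n + k)) m ω : Set G), greenTail Γ 0 (a⁻¹ * b)).trans ?_
  -- In `greenSum` the past is indexed by the number of steps before time `n`, hence the reversal.
  rw [greenSum, ← Finset.sum_range_reflect]
  refine Finset.sum_le_sum fun i hi => ?_
  rw [Finset.mem_range] at hi
  rw [tsum_image (fun b => greenTail Γ 0 ((walk X 1 (n + 1 - 1 - i) ω)⁻¹ * b))
    (mul_right_injective S).injOn]
  refine (tsum_walkRange_le (fun k => X (n + k)) m ω fun b =>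
    greenTail Γ 0 ((walk X 1 (n + 1 - 1 - i) ω)⁻¹ * (S * b))).trans_eq ?_
  refine Finset.sum_congr rfl fun j _ => ?_
  congr 1
  rw [inv_mul_eq_iff_eq_mul]
  have h1 := block_mul_block X 0 n j ω
  have h2 := block_mul_block X 0 (n - i) (i + j) ω
  rw [zero_add] at h1 h2
  rw [show n - i + (i + j) = n + j by omega] at h2
  simp only [S, walk_one_eq_block, Nat.add_sub_cancel]
  rw [h2, ← h1, block, block]
  simp [block]

/-- The capacity of the range of the walk with steps `Y`. -/
noncomputable def capRangeOf {Ω' : Type*} (P : Measure Ω) (X : ℕ → Ω → G) (Y : ℕ → Ω' → G) (n : ℕ)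
    (ω : Ω') : ℝ :=
  (cap P X (walkRange Y n ω)).toReal

lemma capRange_eq_capRangeOf (n : ℕ) : capRange P X n = capRangeOf P X X n := rfl

/-- The σ-algebra on `Ω'` is left free so that the same lemma yields measurability with respect to a
block of steps, and on path space. -/
lemma measurable_capRangeOf {Ω' : Type*} {mΩ' : MeasurableSpace Ω'} {Y : ℕ → Ω' → G} (n : ℕ)
    (hY : ∀ k, k ≤ n → Measurable (walk Y 1 k)) : Measurable (capRangeOf P X Y n) := by
  have h1 : Measurable fun ω (k : Fin (n + 1)) => walk Y 1 k ω :=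
    measurable_pi_lambda _ fun k => hY k (by omega)
  have h2 : Measurable fun w : Fin (n + 1) → G => (cap P X (Set.range w)).toReal :=
    Measurable.of_discrete
  have e : capRangeOf P X Y n = (fun w : Fin (n + 1) → G => (cap P X (Set.range w)).toReal)
      ∘ fun ω (k : Fin (n + 1)) => walk Y 1 k ω := by
    ext ω
    simp only [capRangeOf, walkRange_eq_range, Function.comp]
  rw [e]
  exact h2.comp h1

lemma capRangeOf_nonneg {Ω' : Type*} (Y : ℕ → Ω' → G) (n : ℕ) (ω : Ω') :
    0 ≤ capRangeOf P X Y n ω := ENNReal.toReal_nonneg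

lemma capRangeOf_le [IsProbabilityMeasure P] {Ω' : Type*} (Y : ℕ → Ω' → G) (n : ℕ) (ω : Ω') :
    capRangeOf P X Y n ω ≤ (n + 1 : ℕ) :=
  ENNReal.toReal_le_of_le_ofReal (by positivity)
    ((cap_walkRange_le Y n ω).trans_eq (ENNReal.ofReal_natCast _).symm)

lemma memLp_capRangeOf [IsProbabilityMeasure P] {Ω' : Type*} [MeasurableSpace Ω'] {Q : Measure Ω'}
    [IsProbabilityMeasure Q] {Y : ℕ → Ω' → G} (n : ℕ)
    (hY : ∀ k, k ≤ n → Measurable (walk Y 1 k)) : MemLp (capRangeOf P X Y n) 2 Q :=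
  MemLp.of_bound (measurable_capRangeOf n hY).aestronglyMeasurable (n + 1 : ℕ)
    (Eventually.of_forall fun ω => by
      rw [Real.norm_of_nonneg (capRangeOf_nonneg Y n ω)]
      exact capRangeOf_le Y n ω)

lemma abs_capRange_add_sub_le [IsProbabilityMeasure P] (hX : IsStepSequence Γ P X)
    (hsymm : ∀ γ ∈ Γ, γ⁻¹ ∈ Γ) {n m : ℕ} {ω : Ω} (hfin : greenSum Γ X n m ω ≠ ∞) :
    |capRange P X (n + m) ω
      - (capRange P X n ω + capRangeOf P X (fun k => X (n + k)) m ω)|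
      ≤ 3 * (greenSum Γ X n m ω).toReal := by
  have f1 : cap P X (walkRange X n ω) ≠ ∞ :=
    ((cap_walkRange_le X n ω).trans_lt (ENNReal.natCast_lt_top _)).ne
  have f2 : cap P X (walkRange (fun k => X (n + k)) m ω) ≠ ∞ :=
    ((cap_walkRange_le _ m ω).trans_lt (ENNReal.natCast_lt_top _)).ne
  have f3 : cap P X (walkRange X (n + m) ω) ≠ ∞ :=
    ((cap_walkRange_le X (n + m) ω).trans_lt (ENNReal.natCast_lt_top _)).ne
  have h1 := ENNReal.toReal_mono (ENNReal.add_ne_top.2 ⟨f1, f2⟩)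
    (cap_walkRange_add_le (P := P) (X := X) n m ω)
  have h2 := ENNReal.toReal_mono (ENNReal.add_ne_top.2 ⟨f3, ENNReal.mul_ne_top (by simp) hfin⟩)
    (le_cap_walkRange_add hX hsymm n m ω)
  rw [ENNReal.toReal_add f1 f2] at h1 h2
  rw [ENNReal.toReal_add f3 (ENNReal.mul_ne_top (by simp) hfin), ENNReal.toReal_mul] at h2
  simp only [ENNReal.toReal_ofNat] at h2
  simp only [capRange, capRangeOf]
  have : 0 ≤ (greenSum Γ X n m ω).toReal := ENNReal.toReal_nonneg
  rw [abs_le]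
  constructor <;> linarith

end Range

/-! ### Almost subadditive sequences and the square-root recursion. -/

section AlmostSubadditive

lemma three_rpow_le : (3 : ℝ) ^ (3 / 4 : ℝ) ≤ 2.3 := by
  rw [← pow_le_pow_iff_left₀ (by positivity) (by norm_num) (n := 4) (by norm_num),
    ← Real.rpow_natCast, ← Real.rpow_mul (by norm_num)]
  norm_num

lemma two_rpow_le : (2 : ℝ) ^ (3 / 4 : ℝ) ≤ 1.69 := by
  rw [← pow_le_pow_iff_left₀ (by positivity) (by norm_num) (n := 4) (by norm_num),
    ← Real.rpow_natCast, ← Real.rpow_mul (by norm_num)]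
  norm_num

/-- Strict concavity gain of the power 3/4 under halving: the parts are at least q/3 and q/2, and
1/2.3 + 1/1.69 > 1.02. -/
lemma rpow_half_add_half_ge {q : ℕ} (hq : 2 ≤ q) :
    1.02 * (q : ℝ) ^ (3 / 4 : ℝ)
      ≤ ((q / 2 : ℕ) : ℝ) ^ (3 / 4 : ℝ) + ((q - q / 2 : ℕ) : ℝ) ^ (3 / 4 : ℝ) := by
  have h1 : (q : ℝ) ≤ 3 * ((q / 2 : ℕ) : ℝ) := by
    have : q ≤ 3 * (q / 2) := by omega
    exact_mod_cast this
  have h2 : (q : ℝ) ≤ 2 * ((q - q / 2 : ℕ) : ℝ) := by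
    have : q ≤ 2 * (q - q / 2) := by omega
    exact_mod_cast this
  have h3 := Real.rpow_le_rpow (by positivity) h1 (z := 3 / 4) (by norm_num)
  have h4 := Real.rpow_le_rpow (by positivity) h2 (z := 3 / 4) (by norm_num)
  rw [Real.mul_rpow (by norm_num) (by positivity)] at h3 h4
  have h5 := h3.trans (mul_le_mul_of_nonneg_right three_rpow_le (by positivity))
  have h6 := h4.trans (mul_le_mul_of_nonneg_right two_rpow_le (by positivity))
  have : 0 ≤ (q : ℝ) ^ (3 / 4 : ℝ) := by positivity
  linarith

/-- Induction by halving. The correction -50E q^(3/4) gains 50 · 0.02 = 1 unit of E q^(3/4) at each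
halving, exactly the error to be paid. -/
lemma le_of_almost_subadditive {z : ℕ → ℝ} {E : ℝ}
    (h : ∀ n m : ℕ, 1 ≤ n → 1 ≤ m →
      z (n + m) ≤ z n + z m + E * ((n + m : ℕ) : ℝ) ^ (3 / 4 : ℝ)) (hE : 0 ≤ E)
    {q : ℕ} (hq : 1 ≤ q) :
    z q ≤ q * z 1 + 50 * E * (q - (q : ℝ) ^ (3 / 4 : ℝ)) := by
  induction q using Nat.strong_induction_on with
  | _ q ih =>
    rcases Nat.lt_or_ge q 2 with hq2 | hq2
    · obtain rfl : q = 1 := by omega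
      simp
    have h1 := ih (q / 2) (by omega) (by omega)
    have h2 := ih (q - q / 2) (by omega) (by omega)
    have h3 := h (q / 2) (q - q / 2) (by omega) (by omega)
    have hsum : q / 2 + (q - q / 2) = q := by omega
    rw [hsum] at h3
    have h4 := mul_le_mul_of_nonneg_left (rpow_half_add_half_ge hq2) hE
    have h5 : ((q / 2 : ℕ) : ℝ) + ((q - q / 2 : ℕ) : ℝ) = q := by exact_mod_cast hsum
    have h6 : ((q - q / 2 : ℕ) : ℝ) = q - ((q / 2 : ℕ) : ℝ) := by linarith
    rw [h6] at h2 h4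
    linarith

lemma rpow_div_eq {n : ℕ} (hn : 1 ≤ n) :
    (n : ℝ) ^ (3 / 4 : ℝ) / n = (n : ℝ) ^ (-(1 / 4) : ℝ) := by
  have : (0 : ℝ) < n := by exact_mod_cast hn
  rw [show (-(1 / 4) : ℝ) = 3 / 4 - 1 by norm_num, Real.rpow_sub this, Real.rpow_one]

lemma tendsto_rpow_neg_quarter :
    Tendsto (fun n : ℕ => (n : ℝ) ^ (-(1 / 4) : ℝ)) atTop (𝓝 0) :=
  (tendsto_rpow_neg_atTop (by norm_num)).comp tendsto_natCast_atTop_atTop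

/-- A nonnegative sequence that is subadditive up to an error of order `n ^ (3 / 4)` has a
linear growth rate. -/
theorem exists_tendsto_div_of_almost_subadditive {x : ℕ → ℝ} (hx : ∀ n, 0 ≤ x n) {E : ℝ}
    (hE : 0 ≤ E) (h : ∀ n m : ℕ, 1 ≤ n → 1 ≤ m →
      x (n + m) ≤ x n + x m + E * ((n + m : ℕ) : ℝ) ^ (3 / 4 : ℝ)) :
    ∃ L : ℝ, Tendsto (fun n : ℕ => x n / (n : ℝ)) atTop (𝓝 L) := by
  set A : ℝ := x 1 + 50 * E with hA
  have hA0 : 0 ≤ A := by have := hx 1; positivity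
  have hlin : ∀ n : ℕ, 1 ≤ n → x n ≤ A * n := by
    intro n hn
    have h1 := le_of_almost_subadditive h hE hn
    have : 0 ≤ 50 * E * (n : ℝ) ^ (3 / 4 : ℝ) := by positivity
    rw [hA]
    linarith
  have hmult : ∀ k q : ℕ, 1 ≤ k → 1 ≤ q →
      x (q * k) ≤ q * (x k + 50 * E * (k : ℝ) ^ (3 / 4 : ℝ)) := by
    intro k q hk hq
    -- Along multiples of `k` the sequence is again almost subadditive, with the error constant
    -- scaled by k^(3/4).
    have h1 := le_of_almost_subadditive (z := fun q => x (q * k))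
      (E := E * (k : ℝ) ^ (3 / 4 : ℝ)) (fun n m hn hm => by
        have := h (n * k) (m * k) (Nat.mul_pos hn hk) (Nat.mul_pos hm hk)
        rw [← add_mul, Nat.cast_mul, Real.mul_rpow (by positivity) (by positivity)] at this
        linarith) (by positivity) hq
    simp only [one_mul] at h1
    have : 0 ≤ 50 * (E * (k : ℝ) ^ (3 / 4 : ℝ)) * (q : ℝ) ^ (3 / 4 : ℝ) := by positivity
    linarith
  have hbound : ∀ k N : ℕ, 1 ≤ k → k ≤ N →
      x N / N ≤ x k / k + 50 * E * (k : ℝ) ^ (-(1 / 4) : ℝ)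
        + (A * k / N + E * (N : ℝ) ^ (-(1 / 4) : ℝ)) := by
    intro k N hk hkN
    have hk0 : (0 : ℝ) < k := by exact_mod_cast hk
    have hN0 : (0 : ℝ) < N := by exact_mod_cast hk.trans hkN
    set q := N / k
    have hq : 1 ≤ q := (Nat.one_le_div_iff hk).2 hkN
    have hdecomp : q * k + N % k = N := by rw [mul_comm]; exact Nat.div_add_mod N k
    have h1 : x N ≤ x (q * k) + A * k + E * (N : ℝ) ^ (3 / 4 : ℝ) := by
      rcases Nat.eq_zero_or_pos (N % k) with h0 | h0
      · rw [h0, add_zero] at hdecomp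
        rw [hdecomp]
        have : 0 ≤ E * (N : ℝ) ^ (3 / 4 : ℝ) := by positivity
        have : 0 ≤ A * k := by positivity
        linarith
      · have h2 := h (q * k) (N % k) (Nat.mul_pos hq hk) h0
        rw [hdecomp] at h2
        have h3 : ((N % k : ℕ) : ℝ) ≤ k := by exact_mod_cast (Nat.mod_lt N hk).le
        have h4 := (hlin _ h0).trans (mul_le_mul_of_nonneg_left h3 hA0)
        linarith
    have h2 := hmult k q hk hq
    have h3 : (q : ℝ) ≤ N / k := by
      rw [le_div_iff₀ hk0]
      exact_mod_cast Nat.div_mul_le_self N k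
    have h4 : (q : ℝ) * (x k + 50 * E * (k : ℝ) ^ (3 / 4 : ℝ))
        ≤ N / k * (x k + 50 * E * (k : ℝ) ^ (3 / 4 : ℝ)) := by
      have := hx k
      gcongr
    rw [← rpow_div_eq hk, ← rpow_div_eq (hk.trans hkN), div_le_iff₀ hN0]
    calc x N ≤ N / k * (x k + 50 * E * (k : ℝ) ^ (3 / 4 : ℝ)) + A * k
          + E * (N : ℝ) ^ (3 / 4 : ℝ) := by linarith
      _ = _ := by field_simp; ring
  set u : ℕ → ℝ := fun n => x n / (n : ℝ) with hu
  have hu0 : ∀ n, 0 ≤ u n := fun n => div_nonneg (hx n) (Nat.cast_nonneg n)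
  have huA : ∀ᶠ n in atTop, u n ≤ A := by
    filter_upwards [eventually_ge_atTop 1] with n hn
    have : (0 : ℝ) < n := by exact_mod_cast hn
    rw [hu]
    simp only
    rw [div_le_iff₀ this]
    exact hlin n hn
  have hbdd : IsBoundedUnder (· ≤ ·) atTop u := ⟨A, by simpa using huA⟩
  have hbdd' : IsBoundedUnder (· ≥ ·) atTop u := isBoundedUnder_of_eventually_ge (Eventually.of_forall hu0)
  have hle : limsup u atTop ≤ liminf u atTop := by
    refine le_of_forall_pos_le_add fun ε hε => ?_
    have hf : ∃ᶠ k in atTop, u k < liminf u atTop + ε / 3 :=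
      frequently_lt_of_liminf_lt hbdd.isCoboundedUnder_ge (by linarith)
    have hev : ∀ᶠ k : ℕ in atTop, 50 * E * (k : ℝ) ^ (-(1 / 4) : ℝ) < ε / 3 := by
      have := tendsto_rpow_neg_quarter.const_mul (50 * E)
      rw [mul_zero] at this
      exact this.eventually (gt_mem_nhds (by positivity))
    -- The block length must have a ratio near the liminf and also be large, since the error
    -- k^(-1/4) is small only then.
    obtain ⟨k, ⟨hk1, hk2⟩, hk3⟩ := ((hf.and_eventually hev).and_eventually
      (eventually_ge_atTop 1)).exists
    have hev2 : ∀ᶠ N : ℕ in atTop, A * k / N + E * (N : ℝ) ^ (-(1 / 4) : ℝ) < ε / 3 := by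
      have := (tendsto_const_div_atTop_nhds_zero_nat (A * k)).add
        (tendsto_rpow_neg_quarter.const_mul E)
      rw [mul_zero, add_zero] at this
      exact this.eventually (gt_mem_nhds (by positivity))
    refine limsup_le_of_le hbdd'.isCoboundedUnder_le ?_
    filter_upwards [hev2, eventually_ge_atTop k] with N hN hkN
    have := hbound k N hk3 hkN
    simp only [hu] at hk1 ⊢
    linarith
  exact ⟨_, tendsto_of_le_liminf_of_limsup_le le_rfl hle hbdd hbdd'⟩

/-- A nonnegative sequence satisfying the variance recursion with error of order `n ^ (1 / 4)` in
standard deviation has a linear growth rate. -/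
theorem exists_tendsto_div_of_sqrt_recursion {a : ℕ → ℝ} (ha : ∀ n, 0 ≤ a n) {C : ℝ} (hC : 0 ≤ C)
    (h : ∀ n m : ℕ, 1 ≤ n → 1 ≤ m →
      a (n + m) ≤ a n + a m + 2 * √((a n + a m) * (C * ((n + m : ℕ) : ℝ) ^ (1 / 2 : ℝ)))
        + C * ((n + m : ℕ) : ℝ) ^ (1 / 2 : ℝ)) :
    ∃ L : ℝ, Tendsto (fun n : ℕ => a n / (n : ℝ)) atTop (𝓝 L) := by
  -- Chosen so that T² ≥ a 1 + 50E, the case q = 1 of the linear bound, although `E` itself depends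
  -- on `T`.
  set T : ℝ := 100 * √C + 50 * C + a 1 + 1 with hT
  have hs : 0 ≤ √C := Real.sqrt_nonneg C
  have ha1 := ha 1
  have hT1 : 1 ≤ T := by rw [hT]; linarith
  set E : ℝ := 2 * (T * √C) + C with hE
  have hE0 : 0 ≤ E := by positivity
  have hstep : ∀ n m : ℕ, 1 ≤ n → 1 ≤ m → a n + a m ≤ T ^ 2 * ((n + m : ℕ) : ℝ) →
      a (n + m) ≤ a n + a m + E * ((n + m : ℕ) : ℝ) ^ (3 / 4 : ℝ) := by
    intro n m hn hm hnm
    refine (h n m hn hm).trans ?_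
    set N : ℝ := ((n + m : ℕ) : ℝ) with hN
    have hN1 : 1 ≤ N := by rw [hN]; exact_mod_cast hn.trans (Nat.le_add_right n m)
    have hN0 : 0 ≤ N := by linarith
    have h1 : N ^ (1 / 2 : ℝ) ≤ N ^ (3 / 4 : ℝ) :=
      Real.rpow_le_rpow_of_exponent_le hN1 (by norm_num)
    have h2 : √((a n + a m) * (C * N ^ (1 / 2 : ℝ))) ≤ T * √C * N ^ (3 / 4 : ℝ) := by
      rw [Real.sqrt_le_left (by positivity)]
      have e1 : (N ^ (3 / 4 : ℝ)) ^ 2 = N * N ^ (1 / 2 : ℝ) := by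
        rw [← Real.rpow_natCast, ← Real.rpow_mul hN0]
        nth_rewrite 2 [← Real.rpow_one N]
        rw [← Real.rpow_add (by linarith)]
        norm_num
      rw [mul_pow, mul_pow, Real.sq_sqrt hC, e1]
      calc (a n + a m) * (C * N ^ (1 / 2 : ℝ)) ≤ T ^ 2 * N * (C * N ^ (1 / 2 : ℝ)) := by gcongr
        _ = _ := by ring
    have h3 := mul_le_mul_of_nonneg_left h1 hC
    rw [hE]
    linarith
  -- Halving again: the inductive bound on the two halves supplies the linear growth that `hstep`
  -- needs to control the square root.
  have hlin : ∀ q : ℕ, 1 ≤ q → a q ≤ T ^ 2 * q - 50 * E * (q : ℝ) ^ (3 / 4 : ℝ) := by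
    intro q
    induction q using Nat.strong_induction_on with
    | _ q ih =>
      intro hq
      rcases Nat.lt_or_ge q 2 with hq2 | hq2
      · obtain rfl : q = 1 := by omega
        simp only [Nat.cast_one, Real.one_rpow, mul_one]
        have h1 : T ^ 2 = 100 * (T * √C) + (50 * C + a 1 + 1) * T := by
          rw [pow_two]
          nth_rewrite 2 [hT]
          ring
        have h2 : 50 * C + a 1 + 1 ≤ (50 * C + a 1 + 1) * T :=
          le_mul_of_one_le_right (by positivity) hT1
        rw [hE]
        linarith
      have h1 := ih (q / 2) (by omega) (by omega)
      have h2 := ih (q - q / 2) (by omega) (by omega)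
      have hsum : q / 2 + (q - q / 2) = q := by omega
      have h4 := mul_le_mul_of_nonneg_left (rpow_half_add_half_ge hq2) hE0
      have h5 : ((q - q / 2 : ℕ) : ℝ) = q - ((q / 2 : ℕ) : ℝ) := by
        rw [eq_sub_iff_add_eq']
        exact_mod_cast hsum
      have h6 : 0 ≤ E * (q : ℝ) ^ (3 / 4 : ℝ) := by positivity
      rw [h5] at h2 h4
      have h3 := hstep (q / 2) (q - q / 2) (by omega) (by omega) (by
        rw [hsum]
        linarith)
      rw [hsum] at h3
      linarith
  refine exists_tendsto_div_of_almost_subadditive ha hE0 fun n m hn hm => hstep n m hn hm ?_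
  have h1 : 0 ≤ 50 * E * (n : ℝ) ^ (3 / 4 : ℝ) := by positivity
  have h2 : 0 ≤ 50 * E * (m : ℝ) ^ (3 / 4 : ℝ) := by positivity
  have := hlin n hn
  have := hlin m hm
  push_cast
  linarith

end AlmostSubadditive

/-! ### Cauchy–Schwarz for variances. -/

section Variance

variable {Ω : Type*} [MeasurableSpace Ω] {P : Measure Ω} [IsProbabilityMeasure P]

/-- The quadratic t ↦ Var(A - tB) is nonnegative, so its discriminant is not positive. -/
lemma covariance_le_sqrt {A B : Ω → ℝ} (hA : MemLp A 2 P) (hB : MemLp B 2 P) :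
    covariance A B P ≤ √(variance A P * variance B P) := by
  have h : ∀ t : ℝ, 0 ≤ variance B P * (t * t) + (-2 * covariance A B P) * t + variance A P := by
    intro t
    have h1 := variance_nonneg (A - t • B) P
    rw [variance_sub hA (hB.const_smul t), variance_smul, covariance_smul_right] at h1
    linarith
  have h2 := discrim_le_zero h
  rw [discrim] at h2
  exact Real.le_sqrt_of_sq_le (by linarith)

lemma variance_add_le {A B : Ω → ℝ} (hA : MemLp A 2 P) (hB : MemLp B 2 P) {w : ℝ}
    (hw : variance B P ≤ w) :
    variance (A + B) P ≤ variance A P + 2 * √(variance A P * w) + w := by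
  rw [variance_add hA hB]
  have h1 := covariance_le_sqrt hA hB
  have h2 : √(variance A P * variance B P) ≤ √(variance A P * w) :=
    Real.sqrt_le_sqrt (mul_le_mul_of_nonneg_left hw (variance_nonneg _ _))
  linarith

end Variance

/-! ### The variance recursion for the capacity of the range. -/

section Recursion

variable {G Ω : Type*} [Group G] [MeasurableSpace G] [DiscreteMeasurableSpace G] [Countable G]
  [MeasurableSpace Ω] {Γ : Finset G} {P : Measure Ω} {X : ℕ → Ω → G} {K : ℝ≥0∞}

lemma IsStepSequence.measurable_walk (hX : IsStepSequence Γ P X) (k : ℕ) :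
    Measurable (walk X 1 k) := by
  rw [walk_one_eq_block]
  exact hX.measurable_block 0 k

lemma IsStepSequence.measurable_walk_shift (hX : IsStepSequence Γ P X) (n k : ℕ) :
    Measurable (walk (fun i => X (n + i)) 1 k) :=
  hX.measurable_block n k

lemma IsStepSequence.indepFun_capRange (hX : IsStepSequence Γ P X) (n m : ℕ) :
    IndepFun (capRange P X n) (capRangeOf P X (fun k => X (n + k)) m) P := by
  refine hX.indepFun (S := Set.Ico 0 n) (T := Set.Ici n) ?_ ?_ ?_
  · exact Set.disjoint_left.2 fun k h1 h2 => not_lt.2 h2 h1.2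
  · rw [capRange_eq_capRangeOf]
    refine measurable_capRangeOf n fun k hk => ?_
    rw [walk_one_eq_block]
    exact RangeCapacity.measurable_block X 0 k (Set.Ico_subset_Ico le_rfl (by omega))
  · exact measurable_capRangeOf m fun k _ =>
      RangeCapacity.measurable_block X n k Set.Ico_subset_Ici_self

/-- The shifted and original step sequences have the same infinite product law, and both capacities
are one measurable functional of the path, realised through the coordinate process. -/
lemma IsStepSequence.identDistrib_capRange [IsProbabilityMeasure P] (hX : IsStepSequence Γ P X)
    (n m : ℕ) : IdentDistrib (capRangeOf P X (fun k => X (n + k)) m) (capRange P X m) P P := by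
  have hm1 : Measurable fun ω (k : ℕ) => X (n + k) ω := measurable_pi_lambda _ fun k => hX.meas _
  have hm2 : Measurable fun ω (k : ℕ) => X k ω := measurable_pi_lambda _ fun k => hX.meas _
  have hseq : IdentDistrib (fun ω (k : ℕ) => X (n + k) ω) (fun ω (k : ℕ) => X k ω) P P := by
    refine ⟨hm1.aemeasurable, hm2.aemeasurable, ?_⟩
    have hi : iIndepFun (fun k => X (n + k)) P := hX.indep.precomp (add_right_injective n)
    rw [hi.map_fun_eq_infinitePi_map fun k => hX.meas _,
      hX.indep.map_fun_eq_infinitePi_map fun k => hX.meas _]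
    simp_rw [hX.law]
  have hwalk : ∀ (Y : ℕ → Ω → G) (k : ℕ) (ω : Ω),
      walk (fun i (y : ℕ → G) => y i) 1 k (fun i => Y i ω) = walk Y 1 k ω := by
    intro Y k ω
    induction k with
    | zero => rfl
    | succ k ih => simp only [walk, ih]
  have hcap : ∀ (Y : ℕ → Ω → G) (ω : Ω),
      capRangeOf P X (fun i (y : ℕ → G) => y i) m (fun i => Y i ω) = capRangeOf P X Y m ω := by
    intro Y ω
    simp only [capRangeOf, walkRange, hwalk]
  have hmeas : Measurable (capRangeOf P X (fun i (y : ℕ → G) => y i) m) := by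
    refine measurable_capRangeOf m fun k hk => ?_
    clear hk
    induction k with
    | zero => exact measurable_const
    | succ k ih => exact ih.mul (measurable_pi_apply k)
  have := hseq.comp hmeas
  simpa only [Function.comp_def, hcap, capRange_eq_capRangeOf] using this

lemma greenSum_ne_top (hK : GreenDecay Γ K) (hKtop : K ≠ ∞) (n m : ℕ) (ω : Ω) :
    greenSum Γ X n m ω ≠ ∞ := by
  refine ENNReal.sum_ne_top.2 fun i _ => ENNReal.sum_ne_top.2 fun j _ => ?_
  have := hK 0 (block X (n - i) (i + j) ω)
  refine (this.trans_lt ?_).ne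
  simpa using hKtop.lt_top

lemma exists_variance_recursion [IsProbabilityMeasure P] (hX : IsStepSequence Γ P X)
    (hsymm : ∀ γ ∈ Γ, γ⁻¹ ∈ Γ) (hK : GreenDecay Γ K) (hKtop : K ≠ ∞) :
    ∃ C : ℝ, 0 ≤ C ∧ ∀ n m : ℕ, 1 ≤ n → 1 ≤ m →
      variance (capRange P X (n + m)) P ≤ variance (capRange P X n) P + variance (capRange P X m) P
        + 2 * √((variance (capRange P X n) P + variance (capRange P X m) P)
          * (C * ((n + m : ℕ) : ℝ) ^ (1 / 2 : ℝ))) + C * ((n + m : ℕ) : ℝ) ^ (1 / 2 : ℝ) := by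
  obtain ⟨C, hC, hbound⟩ := exists_lintegral_greenSum_sq_le hX hK hKtop
  refine ⟨9 * C, by positivity, fun n m hn hm => ?_⟩
  set V := capRangeOf P X (fun k => X (n + k)) m with hV
  have hLp : ∀ k, MemLp (capRange P X k) 2 P := fun k =>
    memLp_capRangeOf k fun i _ => hX.measurable_walk i
  have hLV : MemLp V 2 P := memLp_capRangeOf m fun i _ => hX.measurable_walk_shift n i
  -- The error of additivity; its variance is at most its second moment, where 9 is the square of
  -- the 3 in `abs_capRange_add_sub_le`.
  set D := capRange P X (n + m) - (capRange P X n + V) with hD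
  have hLD : MemLp D 2 P := (hLp _).sub ((hLp n).add hLV)
  have hsum : capRange P X (n + m) = (capRange P X n + V) + D := by rw [hD]; abel
  have hvar : variance (capRange P X n + V) P
      = variance (capRange P X n) P + variance (capRange P X m) P := by
    rw [(hX.indepFun_capRange n m).variance_add (hLp n) hLV,
      (hX.identDistrib_capRange n m).variance_eq]
  have hw : variance D P ≤ 9 * C * ((n + m : ℕ) : ℝ) ^ (1 / 2 : ℝ) := by
    refine (variance_le_expectation_sq hLD.aestronglyMeasurable).trans ?_
    rw [integral_eq_lintegral_of_nonneg_ae (f := D ^ 2) (Eventually.of_forall fun ω => sq_nonneg (D ω))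
      (hLD.aestronglyMeasurable.pow 2)]
    refine ENNReal.toReal_le_of_le_ofReal (by positivity) ?_
    have hpt : ∀ ω, ENNReal.ofReal ((D ^ 2) ω) ≤ 9 * greenSum Γ X n m ω ^ 2 := by
      intro ω
      have hfin := greenSum_ne_top (X := X) hK hKtop n m ω
      have h1 := abs_capRange_add_sub_le hX hsymm hfin
      have h2 : (D ^ 2) ω ≤ 9 * (greenSum Γ X n m ω).toReal ^ 2 := by
        have h3 := pow_le_pow_left₀ (abs_nonneg _) h1 2
        rw [sq_abs] at h3
        calc (D ^ 2) ω = _ := rfl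
          _ ≤ _ := h3
          _ = _ := by ring
      refine (ENNReal.ofReal_le_ofReal h2).trans_eq ?_
      rw [ENNReal.ofReal_mul (by norm_num), ENNReal.ofReal_pow ENNReal.toReal_nonneg,
        ENNReal.ofReal_toReal hfin]
      simp
    refine (lintegral_mono hpt).trans ?_
    rw [lintegral_const_mul _ ((measurable_greenSum hX n m).pow_const 2), mul_assoc,
      ENNReal.ofReal_mul (by norm_num)]
    have : ENNReal.ofReal 9 = 9 := by simp
    rw [this]
    gcongr
    exact hbound n m hn hm
  rw [hsum]
  refine (variance_add_le ((hLp n).add hLV) hLD hw).trans_eq ?_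
  rw [hvar]

end Recursion

lemma countable_of_closure_eq_top {G : Type*} [Group G] {Γ : Finset G}
    (hsymm : ∀ γ ∈ Γ, γ⁻¹ ∈ Γ) (hgen : Subgroup.closure (Γ : Set G) = ⊤) : Countable G := by
  have hsurj : Function.Surjective fun l : List Γ => (l.map Subtype.val).prod := by
    intro x
    obtain ⟨l, hl, rfl⟩ := exists_list_of_closure_eq_top hsymm hgen x
    exact ⟨l.attachWith _ hl, by simp⟩
  exact hsurj.countable

end RangeCapacity

open RangeCapacity in
theorem proposition3p2 {G : Type*} [Group G] [MeasurableSpace G] [DiscreteMeasurableSpace G]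
    (Γ : Finset G) (hsymm : ∀ γ ∈ Γ, γ⁻¹ ∈ Γ) (hgen : Subgroup.closure (Γ : Set G) = ⊤)
    (d : ℕ∞) (hgrowth : RangeCapacity.HasGrowthIndex Γ d) (hd : 6 ≤ d)
    {Ω : Type*} [MeasurableSpace Ω] (P : Measure Ω) [IsProbabilityMeasure P]
    (X : ℕ → Ω → G) (hmeas : ∀ i, Measurable (X i))
    (hlaw : ∀ i, P.map (X i) = uniformOn (Γ : Set G)) (hindep : iIndepFun X P) :
    (∀ n : ℕ, MemLp (RangeCapacity.capRange P X n) 2 P) ∧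
      ∃ L : ℝ, Tendsto (fun n : ℕ => variance (RangeCapacity.capRange P X n) P / (n : ℝ))
        atTop (𝓝 L) := by
  have := countable_of_closure_eq_top hsymm hgen
  have hX : IsStepSequence Γ P X := ⟨hmeas, hlaw, hindep⟩
  have hΓ := hX.nonempty
  obtain ⟨c, hc, hgr⟩ := exists_pow_six_le_growth hgrowth hd
  obtain ⟨M, hM, hheat⟩ := exists_heatKernel_le hsymm hΓ hgen hc hgr
  obtain ⟨K, hKtop, hK⟩ := exists_greenDecay hΓ hM hheat
  obtain ⟨C, hC, hrec⟩ := exists_variance_recursion hX hsymm hK hKtop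
  exact ⟨fun n => memLp_capRangeOf n fun i _ => hX.measurable_walk i,
    exists_tendsto_div_of_sqrt_recursion (fun n => variance_nonneg _ _) hC hrec⟩
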